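/- **The game.** Let $n\ge 3$. Processes $p_0,\dots,p_{n-1}$ are asynchronous, may crash, and share three multi-writer multi-reader registers $R_1,R_2,C$ (with arbitrary initial values). In rounds $j=1,2,\dots$ they run the following code. * *Host* $p_i$, $i\in\{0,1\}$: $R_1\gets[i,j]$; if $i=0$, then $c\gets$ fair coin flip and $C\gets c$; $R_2\gets 0$; $v\gets R_2$; if $v<n-2$, exit the loop and return; otherwise go to round $j+1$. * *Player* $p_i$, $2\le i\le n-1$: $R_1\gets\bot$; $C\gets\bot$; $u_1\gets R_1$; $u_2\gets R_1$; $c\gets C$; if $u_1=\bot$ or $u_2=\bot$ or $c=\bot$, exit the loop and return; if $u_1\ne[c,j]$ or $u_2\ne[1-c,j]$, exit the loop and return; $R_2\gets 0$; $v\gets R_2$; $v\gets v+1$; $R_2\gets v$; go to round $j+1$. Processes that have returned continue to take (idle) steps. A process is *correct* in a run if it takes infinitely many steps. **Registers.** Each register is a wait-free implementation: every operation of a process that keeps taking steps gets a response. Let $\mathcal H$ be the set of histories of an implementation (invocations, responses and internal steps). A *linearization function* for $\mathcal H$ maps each $H\in\mathcal H$ to a sequential history $f(H)$ that contains all complete operations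 of $H$ and possibly some pending ones (with matching responses added), in which $o$ is before $o'$ whenever $o$ precedes $o'$ in $H$, and in which each read returns the value of the last write before it, or the initial value if there is none. An implementation is *write strongly-linearizable* if $\mathcal H$ has a linearization function $f$ such that for all $G,H\in\mathcal H$ with $G$ a prefix of $H$, the sequence of writes in $f(G)$ is a prefix of the sequence of writes in $f(H)$. A *strong adversary* schedules every step (including the internal steps of the registers) knowing the whole run so far, including the outcomes of all past coin flips, but not those of future ones. **Theorem.** If $R_1$, $R_2$ and $C$ are write strongly-linearizable, then against every strong adversary the game terminates with probability $1$, i.e. with probability $1$ all correct processes return. Moreover, for every round $j\ge 1$, with probability at least $1/2$ no process enters round $j+1$. -/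

import Mathlib

namespace HostPlayer

/-! ### Register implementations and their histories -/

/-- Invocation of an operation on a register with values in `V`. -/
inductive Invocation (V : Type) where
  | read
  | write (v : V)
  deriving DecidableEq

/-- Response of an operation: a read returns a value, a write returns `ack`. -/
inductive Response (V : Type) where
  | value (v : V)
  | ack
  deriving DecidableEq

/-- The response has the kind that the invocation asks for. -/
def Response.Matches {V : Type} : Response V → Invocation V → Prop
  | .value _, .read => True
  | .ack, .write _ => True
  | _, _ => False

/-- Events of a register implementation used by the processes `P`; `A` is the type of labels of the
internal events. `step p a` is a step that `p` takes inside its pending operation; `env a` is an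
internal event that is not a step of a pending operation (delivery of a message, a helper thread). -/
inductive Event (P V A : Type) where
  | inv (p : P) (i : Invocation V)
  | res (p : P) (a : Response V)
  | step (p : P) (a : A)
  | env (a : A)

/-- A register implementation: an arbitrary labelled transition system. `Conf` is the type of global
configurations (base objects, local variables of the operations, messages in transit). The partial
map `next` gives the configuration after an event, `none` if the event is impossible. Every
nondeterministic choice of the implementation is recorded in the labels. -/
structure RegisterImpl (P V : Type) where
  Act : Type
  Conf : Type
  init : Conf
  next : Conf → Event P V Act → Option Conf

section Histories

variable {P V A : Type}

/-- The invocation of the operation of `p` that is pending after `H`, if there is one. -/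
def pendingOp [DecidableEq P] (H : List (Event P V A)) (p : P) : Option (Invocation V) :=
  H.foldl (fun o e => match e with
    | .inv q i => if q = p then some i else o
    | .res q _ => if q = p then none else o
    | _ => o) none

/-- The event `e` may follow `H`: processes are sequential, responses answer pending operations, and
the steps of an operation are taken while it is pending. -/
def MayFollow [DecidableEq P] (H : List (Event P V A)) : Event P V A → Prop
  | .inv p _ => pendingOp H p = none
  | .res p a => ∃ i, pendingOp H p = some i ∧ a.Matches i
  | .step p _ => pendingOp H p ≠ none
  | .env _ => True

def WellFormed [DecidableEq P] (H : List (Event P V A)) : Prop :=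
  ∀ (G : List (Event P V A)) (e : Event P V A), G ++ [e] <+: H → MayFollow G e

/-- The set of histories of an implementation: all well-formed finite sequences of events that it can
perform from its initial configuration, whatever operations the processes apply. -/
def RegisterImpl.histories [DecidableEq P] (I : RegisterImpl P V) : Set (List (Event P V I.Act)) :=
  {H | WellFormed H ∧ (H.foldlM I.next I.init).isSome}

/-- Wait-freedom: in every infinite history, each operation of a process that takes infinitely many
steps in operations gets a response. -/
def RegisterImpl.WaitFree [DecidableEq P] (I : RegisterImpl P V) : Prop :=
  ∀ e : ℕ → Event P V I.Act, (∀ t, (List.range t).map e ∈ I.histories) →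
    ∀ (p : P) (k : ℕ) (i : Invocation V), e k = .inv p i →
      {t | ∃ a, e t = .step p a}.Infinite → ∃ m > k, ∃ a, e m = .res p a

/-- The operation invoked at position `k` of `H` gets its response `a` at position `m`. -/
def ResponseAt (H : List (Event P V A)) (k m : ℕ) (a : Response V) : Prop :=
  ∃ p i, H[k]? = some (.inv p i) ∧ k < m ∧ H[m]? = some (.res p a) ∧
    ∀ l, k < l → l < m → ∀ a', H[l]? ≠ some (.res p a')

/-- The operation invoked at position `k` precedes the one invoked at position `k'`. -/
def Precedes (H : List (Event P V A)) (k k' : ℕ) : Prop :=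
  ∃ m a, ResponseAt H k m a ∧ m < k'

/-- An operation of a sequential history. It is identified by the position `pos` of its invocation in
the concurrent history. -/
structure SeqOp (P V : Type) where
  pos : ℕ
  proc : P
  inv : Invocation V
  res : Response V

def SeqOp.isWrite (o : SeqOp P V) : Bool :=
  match o.inv with
  | .write _ => true
  | .read => false

/-- Sequential specification of a register that holds `v`: each read returns the value of the last
write before it, or `v` if there is none. -/
def Legal : V → List (SeqOp P V) → Prop
  | _, [] => True
  | v, ⟨_, _, .read, .value u⟩ :: S => u = v ∧ Legal v S
  | _, ⟨_, _, .write u, .ack⟩ :: S => Legal u S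
  | _, _ :: _ => False

/-- `S` is a linearization of `H` for a register with initial value `v₀`: it consists of operations of
`H`, each at most once, has all complete ones with their responses, respects precedence, and is legal. -/
structure IsLinearization (v₀ : V) (H : List (Event P V A)) (S : List (SeqOp P V)) : Prop where
  invoked : ∀ o ∈ S, H[o.pos]? = some (.inv o.proc o.inv)
  once : (S.map SeqOp.pos).Nodup
  complete : ∀ k m a, ResponseAt H k m a → ∃ o ∈ S, o.pos = k ∧ o.res = a
  order : S.Pairwise fun o o' => ¬ Precedes H o'.pos o.pos
  legal : Legal v₀ S

/-- `f` is a linearization function for the set of histories `ℋ`. -/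
def IsLinearizationFunction (v₀ : V) (ℋ : Set (List (Event P V A)))
    (f : List (Event P V A) → List (SeqOp P V)) : Prop :=
  ∀ H ∈ ℋ, IsLinearization v₀ H (f H)

/-- `f` is a write strong-linearization function for `ℋ`. -/
def IsWriteStrongLinearizationFunction (v₀ : V) (ℋ : Set (List (Event P V A)))
    (f : List (Event P V A) → List (SeqOp P V)) : Prop :=
  IsLinearizationFunction v₀ ℋ f ∧
    ∀ G ∈ ℋ, ∀ H ∈ ℋ, G <+: H → (f G).filter SeqOp.isWrite <+: (f H).filter SeqOp.isWrite

/-- The implementation, of a register with initial value `v₀`, is write strongly-linearizable. -/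
def RegisterImpl.WriteStronglyLinearizable [DecidableEq P] (I : RegisterImpl P V) (v₀ : V) : Prop :=
  ∃ f, IsWriteStrongLinearizationFunction v₀ I.histories f

end Histories

/-! ### The game: code of the processes -/

/-- The shared registers. -/
inductive Reg where
  | R1
  | R2
  | C
  deriving DecidableEq

/-- Values of the registers; `none` is `⊥`, and `some (i, j)` in `R1` is `[i, j]`. -/
abbrev Val : Reg → Type
  | .R1 => Option (Fin 2 × ℕ)
  | .R2 => ℕ
  | .C => Option (Fin 2)

instance instDecidableEqVal : ∀ r : Reg, DecidableEq (Val r)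
  | .R1 => inferInstanceAs (DecidableEq (Option (Fin 2 × ℕ)))
  | .R2 => inferInstanceAs (DecidableEq ℕ)
  | .C => inferInstanceAs (DecidableEq (Option (Fin 2)))

/-- Control locations, with the local variables that are still needed. Prefix `h`: hosts (processes
`0` and `1`), prefix `p`: players. -/
inductive Line where
  | hWriteR1
  | hFlip
  | hWriteC (c : Fin 2)
  | hResetR2
  | hReadR2
  | pResetR1
  | pResetC
  | pReadFirst
  | pReadSecond (u₁ : Option (Fin 2 × ℕ))
  | pReadC (u₁ u₂ : Option (Fin 2 × ℕ))
  | pResetR2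
  | pReadR2
  | pWriteR2 (v : ℕ)
  | returned
  deriving DecidableEq

/-- Local state of a process: its round `j`, its control location, and whether the operation at that
location has been invoked and not yet answered. -/
structure Local where
  round : ℕ
  line : Line
  waiting : Bool
  deriving DecidableEq

variable {n : ℕ}

/-- First location of the loop body. -/
def loopStart (p : Fin n) : Line :=
  if p.val < 2 then .hWriteR1 else .pResetR1

/-- The operation that `p` executes at its current location; `none` at a coin flip and after the
return. -/
def opAt (p : Fin n) (l : Local) : Option (Σ r : Reg, Invocation (Val r)) :=
  match l.line with
  | .hWriteR1 => some ⟨.R1, .write (some (if p.val = 0 then 0 else 1, l.round))⟩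
  | .hFlip => none
  | .hWriteC c => some ⟨.C, .write (some c)⟩
  | .hResetR2 => some ⟨.R2, .write (0 : ℕ)⟩
  | .hReadR2 => some ⟨.R2, .read⟩
  | .pResetR1 => some ⟨.R1, .write none⟩
  | .pResetC => some ⟨.C, .write none⟩
  | .pReadFirst => some ⟨.R1, .read⟩
  | .pReadSecond _ => some ⟨.R1, .read⟩
  | .pReadC _ _ => some ⟨.C, .read⟩
  | .pResetR2 => some ⟨.R2, .write (0 : ℕ)⟩
  | .pReadR2 => some ⟨.R2, .read⟩
  | .pWriteR2 v => some ⟨.R2, .write v⟩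
  | .returned => none

/-- Local state of `p` after its operation on `r` is answered with `a`; `none` if `a` does not answer
the operation at the current location. Tests of guards, `v ← v + 1`, and the passage to the next
round are local computations done on the receipt of the response. -/
def afterResponse (p : Fin n) (l : Local) (r : Reg) (a : Response (Val r)) : Option Local :=
  let j := l.round
  match l.line, r, a with
  | .hWriteR1, .R1, .ack => some ⟨j, if p.val = 0 then .hFlip else .hResetR2, false⟩
  | .hWriteC _, .C, .ack => some ⟨j, .hResetR2, false⟩
  | .hResetR2, .R2, .ack => some ⟨j, .hReadR2, false⟩
  | .hReadR2, .R2, .value v =>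
      if v < n - 2 then some ⟨j, .returned, false⟩ else some ⟨j + 1, loopStart p, false⟩
  | .pResetR1, .R1, .ack => some ⟨j, .pResetC, false⟩
  | .pResetC, .C, .ack => some ⟨j, .pReadFirst, false⟩
  | .pReadFirst, .R1, .value u₁ => some ⟨j, .pReadSecond u₁, false⟩
  | .pReadSecond u₁, .R1, .value u₂ => some ⟨j, .pReadC u₁ u₂, false⟩
  | .pReadC _ _, .C, .value none => some ⟨j, .returned, false⟩
  | .pReadC u₁ u₂, .C, .value (some c) =>
      if u₁ = none ∨ u₂ = none then some ⟨j, .returned, false⟩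
      else if u₁ ≠ some (c, j) ∨ u₂ ≠ some (1 - c, j) then some ⟨j, .returned, false⟩
      else some ⟨j, .pResetR2, false⟩
  | .pResetR2, .R2, .ack => some ⟨j, .pReadR2, false⟩
  | .pReadR2, .R2, .value v => some ⟨j, .pWriteR2 (v + 1), false⟩
  | .pWriteR2 _, .R2, .ack => some ⟨j + 1, loopStart p, false⟩
  | _, _, _ => none

/-! ### Runs against a strong adversary -/

variable (I : ∀ r : Reg, RegisterImpl (Fin n) (Val r))

/-- Events of a run: an event of one of the register implementations, a coin flip with its outcome,
or a step of a process that has returned. -/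
inductive GameEvent where
  | reg (r : Reg) (e : Event (Fin n) (Val r) (I r).Act)
  | flip (p : Fin n) (c : Fin 2)
  | idle (p : Fin n)

/-- What an adversary can schedule next. -/
inductive Choice where
  | reg (r : Reg) (e : Event (Fin n) (Val r) (I r).Act)
  | flip (p : Fin n)
  | idle (p : Fin n)

/-- A strong adversary: it sees the whole run so far, with all internal events and all outcomes of
past coin flips, and chooses what happens next. -/
def Adversary : Type := List (GameEvent I) → Choice I

/-- Global state: local states of the processes, configurations of the registers, run so far. -/
structure State where
  loc : Fin n → Local
  conf : ∀ r : Reg, (I r).Conf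
  log : List (GameEvent I)

def initialState : State I where
  loc p := ⟨1, loopStart p, false⟩
  conf r := (I r).init
  log := []

variable {I}

/-- The event that a choice produces if the coin that is flipped, if any, shows `c`. -/
def Choice.toEvent (c : Fin 2) : Choice I → GameEvent I
  | .reg r e => .reg r e
  | .flip p => .flip p c
  | .idle p => .idle p

/-- The event is a step of process `p`. -/
def GameEvent.IsStepOf (p : Fin n) : GameEvent I → Prop
  | .reg _ (.inv q _) => q = p
  | .reg _ (.res q _) => q = p
  | .reg _ (.step q _) => q = p
  | .reg _ (.env _) => False
  | .flip q _ => q = p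
  | .idle q => q = p

/-- Effect of an event on the local states; `none` if the code does not allow the event. -/
def nextLoc (loc : Fin n → Local) : GameEvent I → Option (Fin n → Local)
  | .reg r (.inv p i) =>
      if (loc p).waiting = false ∧ opAt p (loc p) = some ⟨r, i⟩ then
        some (Function.update loc p { loc p with waiting := true })
      else none
  | .reg r (.res p a) =>
      if (loc p).waiting = true then
        (afterResponse p (loc p) r a).map (Function.update loc p)
      else none
  | .reg r (.step p _) =>
      if (loc p).waiting = true ∧ (opAt p (loc p)).map Sigma.fst = some r then some loc else none
  | .reg _ (.env _) => some loc
  | .flip p c =>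
      if (loc p).line = .hFlip then
        some (Function.update loc p { loc p with line := .hWriteC c })
      else none
  | .idle p => if (loc p).line = .returned then some loc else none

/-- Effect of an event on the configurations; `none` if a register does not allow the event. -/
def nextConf (conf : ∀ r : Reg, (I r).Conf) : GameEvent I → Option (∀ r : Reg, (I r).Conf)
  | .reg r e => ((I r).next (conf r) e).map (Function.update conf r)
  | .flip _ _ => some conf
  | .idle _ => some conf

/-- One step of the run; an impossible event leaves the state as it is. -/
def State.apply (s : State I) (e : GameEvent I) : State I :=
  match nextLoc s.loc e, nextConf s.conf e with
  | some loc, some conf => ⟨loc, conf, s.log ++ [e]⟩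
  | _, _ => s

/-- The run under the adversary `𝒮`; `ω t` is the outcome of the coin flip at time `t`, if there is a
coin flip at that time. -/
def run (𝒮 : Adversary I) (ω : ℕ → Fin 2) : ℕ → State I
  | 0 => initialState I
  | t + 1 => (run 𝒮 ω t).apply ((𝒮 (run 𝒮 ω t).log).toEvent (ω t))

/-- A process is correct in a run if it takes infinitely many steps. -/
def Correct (𝒮 : Adversary I) (ω : ℕ → Fin 2) (p : Fin n) : Prop :=
  {t | ∃ e : GameEvent I, e.IsStepOf p ∧ (run 𝒮 ω (t + 1)).log = (run 𝒮 ω t).log ++ [e]}.Infinite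

/-- Process `p` returns in the run. -/
def Returns (𝒮 : Adversary I) (ω : ℕ → Fin 2) (p : Fin n) : Prop :=
  ∃ t, ((run 𝒮 ω t).loc p).line = .returned

/-- Process `p` enters round `j` in the run. -/
def EntersRound (𝒮 : Adversary I) (ω : ℕ → Fin 2) (p : Fin n) (j : ℕ) : Prop :=
  ∃ t, ((run 𝒮 ω t).loc p).round = j

/-- The law of a sequence of independent fair coin flips. -/
noncomputable def coinMeasure : MeasureTheory.Measure (ℕ → Fin 2) :=
  MeasureTheory.Measure.infinitePi fun _ => (PMF.uniformOfFintype (Fin 2)).toMeasure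

end HostPlayer

/-! Call the flip of round `j` bad if it shows the index of the host whose write `[i, j]` comes
first in the linearization of `R1`. A process enters round `j + 1` only if the flips of all rounds
up to `j` are bad, and which outcome is bad is settled before the coin is flipped.

A player that passes the tests of round `j` has reset `R1` and `C`, and has then read `[c, j]` and
`[1 - c, j]` in `R1` and `c` in `C`. Each `[i, j]` is written only once, so `[c, j]` is linearized
before `[1 - c, j]`. The flip comes after the completed write of `[0, j]`. By write
strong-linearizability, nothing can later be inserted before that write, so the order of the two
writes is already determined (`firstWritten`), and the coin has to agree with it
(`exists_flip_of_passed`).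

For this, the value `c` must stem from the flip of round `j` (`exists_write_C`), and hosts must not
run ahead of players (`exists_increment_of_host_read`). A host goes on only if it reads at least `n
- 2` in `R2` after its reset. A player that writes `w + 1` has read `w` after its own reset, so the
values `n - 2, ..., 1` were all written in this round. A player writes one such value per round,
hence all `n - 2` players took part. Values from other rounds are excluded by induction on the round
(`isIncrement_of_isLinearOrder`).

The coin is independent of the past, so flips that are bad in rounds `1, ..., J` have probability at
most `(1 / 2) ^ J` (`measure_badFlips`). This is the second claim, and it bounds the number of
rounds almost surely. A process with infinitely many steps in boundedly many rounds that never
returns would be stuck in one operation, against wait-freedom (`exists_returned`). -/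

namespace HostPlayer

variable {n : ℕ} {I : ∀ r : Reg, RegisterImpl (Fin n) (Val r)}

/-! ### Executions -/

/-- The event `e` takes place at time `t` of the sequence of states `σ`. -/
def Occurs (σ : ℕ → State I) (t : ℕ) (e : GameEvent I) : Prop :=
  ∃ loc conf, nextLoc (σ t).loc e = some loc ∧ nextConf (σ t).conf e = some conf ∧
    σ (t + 1) = ⟨loc, conf, (σ t).log ++ [e]⟩

/-- A sequence of states that starts in the initial state and in which every step is either the
effect of an event or void. -/
structure IsExecution (σ : ℕ → State I) : Prop where
  init : σ 0 = initialState I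
  step : ∀ t, σ (t + 1) = σ t ∨ ∃ e, Occurs σ t e

theorem Occurs.log_succ {σ : ℕ → State I} {t : ℕ} {e : GameEvent I} (h : Occurs σ t e) :
    (σ (t + 1)).log = (σ t).log ++ [e] := by
  obtain ⟨loc, conf, -, -, h⟩ := h
  rw [h]

theorem Occurs.unique {σ : ℕ → State I} {t : ℕ} {e e' : GameEvent I} (h : Occurs σ t e)
    (h' : Occurs σ t e') : e = e' := by
  have := h.log_succ.symm.trans h'.log_succ
  simpa using this

theorem State.apply_eq_or (s : State I) (e : GameEvent I) :
    s.apply e = s ∨ ∃ loc conf, nextLoc s.loc e = some loc ∧ nextConf s.conf e = some conf ∧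
      s.apply e = ⟨loc, conf, s.log ++ [e]⟩ := by
  unfold State.apply
  split
  · next loc conf h1 h2 => exact Or.inr ⟨loc, conf, h1, h2, rfl⟩
  · exact Or.inl rfl

theorem isExecution_run (𝒮 : Adversary I) (ω : ℕ → Fin 2) : IsExecution (run 𝒮 ω) where
  init := rfl
  step t := by
    rcases State.apply_eq_or (run 𝒮 ω t) ((𝒮 (run 𝒮 ω t).log).toEvent (ω t)) with h | h
    · exact Or.inl h
    · exact Or.inr ⟨_, h⟩

theorem occurs_run {𝒮 : Adversary I} {ω : ℕ → Fin 2} {t : ℕ} {e : GameEvent I}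
    (h : Occurs (run 𝒮 ω) t e) : e = (𝒮 (run 𝒮 ω t).log).toEvent (ω t) := by
  rcases State.apply_eq_or (run 𝒮 ω t) ((𝒮 (run 𝒮 ω t).log).toEvent (ω t)) with h' | h'
  · have h1 := h.log_succ
    have h2 : run 𝒮 ω (t + 1) = run 𝒮 ω t := h'
    rw [h2] at h1
    simp at h1
  · exact h.unique h'

/-! ### Local traces -/

/-- Number of a control location in the order of the code. -/
def Line.idx : Line → ℕ
  | .hWriteR1 => 0
  | .hFlip => 1
  | .hWriteC _ => 2
  | .hResetR2 => 3
  | .hReadR2 => 4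
  | .pResetR1 => 0
  | .pResetC => 1
  | .pReadFirst => 2
  | .pReadSecond _ => 3
  | .pReadC _ _ => 4
  | .pResetR2 => 5
  | .pReadR2 => 6
  | .pWriteR2 _ => 7
  | .returned => 8

/-- A measure of the progress of a process. -/
def Local.rank (l : Local) : ℕ := 32 * l.round + 2 * l.line.idx + l.waiting.toNat

/-- Control locations that a process may occupy. -/
def Line.Of (p : Fin n) : Line → Prop
  | .hWriteR1 => p.val < 2
  | .hFlip => p.val = 0
  | .hWriteC _ => p.val = 0
  | .hResetR2 => p.val < 2
  | .hReadR2 => p.val < 2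
  | .returned => True
  | _ => 2 ≤ p.val

/-- A change of the local state of `p` by the event `e`. -/
inductive LocalStep (p : Fin n) (l l' : Local) : GameEvent I → Prop
  | inv (r : Reg) (i : Invocation (Val r)) (hw : l.waiting = false) (ho : opAt p l = some ⟨r, i⟩)
      (h : l' = { l with waiting := true }) : LocalStep p l l' (.reg r (.inv p i))
  | res (r : Reg) (a : Response (Val r)) (hw : l.waiting = true)
      (h : afterResponse p l r a = some l') : LocalStep p l l' (.reg r (.res p a))
  | flip (c : Fin 2) (hl : l.line = .hFlip) (h : l' = { l with line := .hWriteC c }) :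
      LocalStep p l l' (.flip p c)

theorem Occurs.local_step {σ : ℕ → State I} {t : ℕ} {e : GameEvent I} (h : Occurs σ t e)
    (p : Fin n) : (σ (t + 1)).loc p = (σ t).loc p ∨
      LocalStep p ((σ t).loc p) ((σ (t + 1)).loc p) e := by
  obtain ⟨loc, conf, h1, -, h2⟩ := h
  rw [h2]
  simp only
  rcases e with ⟨r, e⟩ | ⟨q, c⟩ | q
  · rcases e with ⟨q, i⟩ | ⟨q, a⟩ | ⟨q, a⟩ | a
    · simp only [nextLoc, Option.ite_none_right_eq_some, Option.some.injEq] at h1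
      obtain ⟨⟨hw, ho⟩, rfl⟩ := h1
      by_cases hq : p = q
      · subst hq
        exact Or.inr (.inv r i hw ho (by simp))
      · exact Or.inl (by simp [hq])
    · simp only [nextLoc, Option.ite_none_right_eq_some, Option.map_eq_some_iff] at h1
      obtain ⟨hw, l', hl', rfl⟩ := h1
      by_cases hq : p = q
      · subst hq
        exact Or.inr (.res r a hw (by simpa using hl'))
      · exact Or.inl (by simp [hq])
    · simp only [nextLoc, Option.ite_none_right_eq_some, Option.some.injEq] at h1
      exact Or.inl (by rw [h1.2])
    · simp only [nextLoc, Option.some.injEq] at h1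
      exact Or.inl (by rw [h1])
  · simp only [nextLoc, Option.ite_none_right_eq_some, Option.some.injEq] at h1
    obtain ⟨hl, rfl⟩ := h1
    by_cases hq : p = q
    · subst hq
      exact Or.inr (.flip c hl (by simp))
    · exact Or.inl (by simp [hq])
  · simp only [nextLoc, Option.ite_none_right_eq_some, Option.some.injEq] at h1
    exact Or.inl (by rw [h1.2])

theorem Occurs.local_step_inv {σ : ℕ → State I} {t : ℕ} {r : Reg} {p : Fin n}
    {i : Invocation (Val r)} (h : Occurs σ t (.reg r (.inv p i))) :
    ((σ t).loc p).waiting = false ∧ opAt p ((σ t).loc p) = some ⟨r, i⟩ ∧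
      (σ (t + 1)).loc p = { (σ t).loc p with waiting := true } := by
  obtain ⟨loc, conf, h1, -, h2⟩ := h
  rw [h2]
  simp only [nextLoc, Option.ite_none_right_eq_some, Option.some.injEq] at h1
  obtain ⟨⟨hw, ho⟩, rfl⟩ := h1
  exact ⟨hw, ho, by simp⟩

theorem Occurs.local_step_res {σ : ℕ → State I} {t : ℕ} {r : Reg} {p : Fin n}
    {a : Response (Val r)} (h : Occurs σ t (.reg r (.res p a))) :
    ((σ t).loc p).waiting = true ∧ afterResponse p ((σ t).loc p) r a = some ((σ (t + 1)).loc p) := by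
  obtain ⟨loc, conf, h1, -, h2⟩ := h
  rw [h2]
  simp only [nextLoc, Option.ite_none_right_eq_some, Option.map_eq_some_iff] at h1
  obtain ⟨hw, l', hl', rfl⟩ := h1
  exact ⟨hw, by simpa using hl'⟩

theorem Occurs.local_step_flip {σ : ℕ → State I} {t : ℕ} {p : Fin n} {c : Fin 2}
    (h : Occurs σ t (.flip p c)) :
    ((σ t).loc p).line = .hFlip ∧ (σ (t + 1)).loc p = { (σ t).loc p with line := .hWriteC c } := by
  obtain ⟨loc, conf, h1, -, h2⟩ := h
  rw [h2]
  simp only [nextLoc, Option.ite_none_right_eq_some, Option.some.injEq] at h1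
  obtain ⟨hl, rfl⟩ := h1
  exact ⟨hl, by simp⟩

/-- All the transitions on receipt of a response. -/
inductive ResponseStep (p : Fin n) (j : ℕ) : Line → ∀ r : Reg, Response (Val r) → Local → Prop
  | hWriteR1_zero (h : p.val = 0) : ResponseStep p j .hWriteR1 .R1 .ack ⟨j, .hFlip, false⟩
  | hWriteR1_one (h : p.val ≠ 0) : ResponseStep p j .hWriteR1 .R1 .ack ⟨j, .hResetR2, false⟩
  | hWriteC (c : Fin 2) : ResponseStep p j (.hWriteC c) .C .ack ⟨j, .hResetR2, false⟩
  | hResetR2 : ResponseStep p j .hResetR2 .R2 .ack ⟨j, .hReadR2, false⟩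
  | hReadR2_return (v : ℕ) (h : v < n - 2) :
      ResponseStep p j .hReadR2 .R2 (.value v) ⟨j, .returned, false⟩
  | hReadR2_loop (v : ℕ) (h : n - 2 ≤ v) :
      ResponseStep p j .hReadR2 .R2 (.value v) ⟨j + 1, loopStart p, false⟩
  | pResetR1 : ResponseStep p j .pResetR1 .R1 .ack ⟨j, .pResetC, false⟩
  | pResetC : ResponseStep p j .pResetC .C .ack ⟨j, .pReadFirst, false⟩
  | pReadFirst (u : Option (Fin 2 × ℕ)) :
      ResponseStep p j .pReadFirst .R1 (.value u) ⟨j, .pReadSecond u, false⟩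
  | pReadSecond (u₁ u₂ : Option (Fin 2 × ℕ)) :
      ResponseStep p j (.pReadSecond u₁) .R1 (.value u₂) ⟨j, .pReadC u₁ u₂, false⟩
  | pReadC_return (u₁ u₂ : Option (Fin 2 × ℕ)) (c : Option (Fin 2)) :
      ResponseStep p j (.pReadC u₁ u₂) .C (.value c) ⟨j, .returned, false⟩
  | pReadC_pass (c : Fin 2) :
      ResponseStep p j (.pReadC (some (c, j)) (some (1 - c, j))) .C (.value (some c))
        ⟨j, .pResetR2, false⟩
  | pResetR2 : ResponseStep p j .pResetR2 .R2 .ack ⟨j, .pReadR2, false⟩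
  | pReadR2 (v : ℕ) : ResponseStep p j .pReadR2 .R2 (.value v) ⟨j, .pWriteR2 (v + 1), false⟩
  | pWriteR2 (v : ℕ) : ResponseStep p j (.pWriteR2 v) .R2 .ack ⟨j + 1, loopStart p, false⟩

/-- This turns the code into a relation that can be inverted by cases. Of the tests only their
success is recorded, since a player that fails them does nothing more. -/
theorem responseStep_of_afterResponse {p : Fin n} {l l' : Local} {r : Reg} {a : Response (Val r)}
    (h : afterResponse p l r a = some l') : ResponseStep p l.round l.line r a l' := by
  obtain ⟨j, line, w⟩ := l
  unfold afterResponse at h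
  simp only at h
  split at h <;> (try split_ifs at h) <;> (try cases h) <;> (try constructor)
  · assumption
  · assumption
  · assumption
  · next h => exact not_lt.mp h
  · next h1 h2 =>
      simp only [not_or, ne_eq, not_not] at h1 h2
      obtain ⟨rfl, rfl⟩ := h2
      constructor

/-- A transition increases the measure of progress and respects the control locations. -/
theorem LocalStep.progress {p : Fin n} {l l' : Local} {e : GameEvent I} (h : LocalStep p l l' e)
    (hl : l.line.Of p) : l.rank < l'.rank ∧ l'.line.Of p ∧ l.round ≤ l'.round ∧
      l'.round ≤ l.round + 1 := by
  cases h with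
  | inv r i hw ho h =>
    subst h
    simp [Local.rank, hw, hl]
  | res r a hw h =>
    have := responseStep_of_afterResponse h
    obtain ⟨j, line, w⟩ := l
    simp only at this hw hl
    subst hw
    have key : ∀ j : ℕ, (Line.idx (loopStart p) = 0) ∧ (loopStart p).Of p := by
      intro j
      unfold loopStart
      split_ifs with h
      · exact ⟨rfl, h⟩
      · exact ⟨rfl, not_lt.mp h⟩
    cases this <;> simp_all [Local.rank, Line.idx, Line.Of] <;> omega
  | flip c hf h =>
    subst h
    rw [hf] at hl
    refine ⟨?_, hl, le_rfl, by simp⟩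
    simp [Local.rank, hf, Line.idx]

namespace IsExecution

variable {σ : ℕ → State I} (hσ : IsExecution σ) (p : Fin n)

include hσ

theorem local_step (t : ℕ) : (σ (t + 1)).loc p = (σ t).loc p ∨
    ∃ e, Occurs σ t e ∧ LocalStep p ((σ t).loc p) ((σ (t + 1)).loc p) e := by
  rcases hσ.step t with h | ⟨e, he⟩
  · exact Or.inl (by rw [h])
  · exact (he.local_step p).imp_right fun h => ⟨e, he, h⟩

theorem line_of (t : ℕ) : ((σ t).loc p).line.Of p := by
  induction t with
  | zero =>
    rw [hσ.init]
    simp only [initialState, loopStart]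
    split_ifs with h
    · exact h
    · exact not_lt.mp h
  | succ t ih =>
    rcases hσ.local_step p t with h | ⟨e, -, h⟩
    · rwa [h]
    · exact (h.progress ih).2.1

theorem progress (t : ℕ) : (σ (t + 1)).loc p = (σ t).loc p ∨
    ((σ t).loc p).rank < ((σ (t + 1)).loc p).rank := by
  rcases hσ.local_step p t with h | ⟨e, -, h⟩
  · exact Or.inl h
  · exact Or.inr (h.progress (hσ.line_of p t)).1

theorem rank_mono : Monotone fun t => ((σ t).loc p).rank := by
  refine monotone_nat_of_le_succ fun t => ?_
  rcases hσ.progress p t with h | h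
  · rw [h]
  · exact h.le

theorem round_mono : Monotone fun t => ((σ t).loc p).round := by
  refine monotone_nat_of_le_succ fun t => ?_
  rcases hσ.local_step p t with h | ⟨e, -, h⟩
  · rw [h]
  · exact (h.progress (hσ.line_of p t)).2.2.1

theorem round_zero : ((σ 0).loc p).round = 1 := by
  rw [hσ.init]; rfl

theorem one_le_round (t : ℕ) : 1 ≤ ((σ t).loc p).round :=
  (hσ.round_zero p).symm.le.trans (hσ.round_mono p (Nat.zero_le t))

theorem loc_eq_of_rank_eq {s t : ℕ} (hst : s ≤ t)
    (h : ((σ t).loc p).rank ≤ ((σ s).loc p).rank) : (σ t).loc p = (σ s).loc p := by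
  induction t, hst using Nat.le_induction with
  | base => rfl
  | succ t hst ih =>
    have h1 := hσ.rank_mono p hst
    simp only at h1
    rcases hσ.progress p t with h2 | h2
    · rw [h2]
      exact ih (by rwa [h2] at h)
    · omega

end IsExecution

/-- `p`, at the location `l`, invokes the operation `i` on `r` at time `t` and gets the response `a`
at time `m`. -/
structure OpDone (σ : ℕ → State I) (p : Fin n) (j : ℕ) (line : Line) (r : Reg)
    (i : Invocation (Val r)) (a : Response (Val r)) (t m : ℕ) : Prop where
  inv : Occurs σ t (.reg r (.inv p i))
  res : Occurs σ m (.reg r (.res p a))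
  lt : t < m
  loc_inv : (σ t).loc p = ⟨j, line, false⟩
  op : opAt p ⟨j, line, false⟩ = some ⟨r, i⟩
  loc_wait : ∀ s, t < s → s ≤ m → (σ s).loc p = ⟨j, line, true⟩
  step : ResponseStep p j line r a ((σ (m + 1)).loc p)

namespace IsExecution

variable {σ : ℕ → State I} (hσ : IsExecution σ) (p : Fin n)

include hσ

/-- A process that waits has invoked the operation at its location. -/
theorem exists_inv_of_waiting {T j : ℕ} {line : Line} (h : (σ T).loc p = ⟨j, line, true⟩) :
    ∃ t < T, ∃ r i, Occurs σ t (.reg r (.inv p i)) ∧ (σ t).loc p = ⟨j, line, false⟩ ∧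
      opAt p ⟨j, line, false⟩ = some ⟨r, i⟩ ∧ ∀ s, t < s → s ≤ T → (σ s).loc p = ⟨j, line, true⟩ := by
  induction T generalizing j line with
  | zero => rw [hσ.init] at h; simp [initialState] at h
  | succ T ih =>
    rcases hσ.local_step p T with h1 | ⟨e, he, h1⟩
    · obtain ⟨t, ht, r, i, h2, h3, h4, h5⟩ := ih (h1 ▸ h)
      refine ⟨t, by omega, r, i, h2, h3, h4, fun s hs hs' => ?_⟩
      rcases hs'.eq_or_lt with rfl | hs'
      · exact h
      · exact h5 s hs (by omega)
    · rw [h] at h1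
      cases h1 with
      | inv r i hw ho h' =>
        have h3 : (σ T).loc p = ⟨j, line, false⟩ := by
          generalize (σ T).loc p = l at *
          obtain ⟨j', line', w⟩ := l
          simp_all
        refine ⟨T, by omega, r, i, he, h3, h3 ▸ ho, fun s hs hs' => ?_⟩
        obtain rfl : s = T + 1 := by omega
        exact h
      | res r a hw h' =>
        have h2 := responseStep_of_afterResponse h'
        generalize ((σ T).loc p).line = line' at h2
        cases h2
      | flip c hl h' =>
        exfalso
        have h3 : (σ T).loc p = ⟨j, .hFlip, true⟩ := by
          generalize (σ T).loc p = l at hl h'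
          obtain ⟨j', line', w⟩ := l
          simp only at hl
          simp only [Local.mk.injEq] at h'
          rw [hl, h'.1, ← h'.2.2]
        obtain ⟨t, ht, r, i, h2, h3, h4, h5⟩ := ih h3
        simp [opAt] at h4

theorem opDone_of_res {m : ℕ} {r : Reg} {a : Response (Val r)}
    (h : Occurs σ m (.reg r (.res p a))) :
    ∃ t i, OpDone σ p ((σ m).loc p).round ((σ m).loc p).line r i a t m := by
  obtain ⟨hw, ha⟩ := h.local_step_res
  have hs := responseStep_of_afterResponse ha
  have hl : (σ m).loc p = ⟨((σ m).loc p).round, ((σ m).loc p).line, true⟩ := by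
    rw [← hw]
  obtain ⟨t, ht, r', i, h1, h2, h3, h4⟩ := hσ.exists_inv_of_waiting p hl
  obtain rfl : r' = r := by
    generalize ((σ m).loc p).line = line at hs h3
    generalize ((σ (m + 1)).loc p) = l' at hs
    cases hs <;> simp [opAt] at h3 <;> exact h3.1.symm
  exact ⟨t, i, h1, h, ht, h2, h3, h4, hs⟩

/-- How a process came to its location. -/
theorem exists_pred {T j : ℕ} {line : Line} (h : (σ T).loc p = ⟨j, line, false⟩) :
    (j = 1 ∧ line = loopStart p) ∨
    (∃ c, line = .hWriteC c ∧ ∃ t < T, Occurs σ t (.flip p c) ∧ (σ t).loc p = ⟨j, .hFlip, false⟩) ∨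
    ∃ j' line' r i a t m, OpDone σ p j' line' r i a t m ∧ m < T ∧
      ResponseStep p j' line' r a ⟨j, line, false⟩ := by
  induction T with
  | zero =>
    rw [hσ.init] at h
    simp only [initialState, Local.mk.injEq, and_true] at h
    exact Or.inl ⟨h.1.symm, h.2.symm⟩
  | succ T ih =>
    rcases hσ.local_step p T with h1 | ⟨e, he, h1⟩
    · rcases ih (h1 ▸ h) with h2 | ⟨c, hc, t, ht, h2⟩ | ⟨j', line', r, i, a, t, m, h2, h3, h4⟩
      · exact Or.inl h2
      · exact Or.inr (Or.inl ⟨c, hc, t, by omega, h2⟩)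
      · exact Or.inr (Or.inr ⟨j', line', r, i, a, t, m, h2, by omega, h4⟩)
    · rw [h] at h1
      cases h1 with
      | inv r i hw ho h' => simp at h'
      | res r a hw h' =>
        obtain ⟨t, i, ho⟩ := hσ.opDone_of_res p he
        exact Or.inr (Or.inr ⟨_, _, r, i, a, t, T, ho, by omega, h ▸ ho.step⟩)
      | flip c hl h' =>
        refine Or.inr (Or.inl ⟨c, ?_, T, by omega, he, ?_⟩)
        · simpa using congrArg Local.line h'
        · generalize (σ T).loc p = l at *
          obtain ⟨j', line', w⟩ := l
          simp_all

/-- The response by which a process passes to the round `j + 1`. -/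
theorem exists_round_succ {T j : ℕ} (hj : 1 ≤ j) (h : j < ((σ T).loc p).round) :
    ∃ line r i a t m, OpDone σ p j line r i a t m ∧ m < T ∧
      ResponseStep p j line r a ⟨j + 1, loopStart p, false⟩ := by
  induction T with
  | zero => rw [hσ.round_zero] at h; omega
  | succ T ih =>
    by_cases h0 : j < ((σ T).loc p).round
    · obtain ⟨line, r, i, a, t, m, h1, h2, h3⟩ := ih h0
      exact ⟨line, r, i, a, t, m, h1, by omega, h3⟩
    rcases hσ.local_step p T with h1 | ⟨e, he, h1⟩
    · rw [h1] at h; omega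
    · cases h1 with
      | inv r i hw ho h' => rw [h'] at h; simp only at h; omega
      | flip c hl h' => rw [h'] at h; simp only at h; omega
      | res r a hw h' =>
        obtain ⟨t, i, ho⟩ := hσ.opDone_of_res p he
        have hs := ho.step
        have hr : ((σ T).loc p).round = j := by
          have : ((σ (T + 1)).loc p).round ≤ ((σ T).loc p).round + 1 :=
            ((LocalStep.res r a hw h' : LocalStep (I := I) p _ _ _).progress (hσ.line_of p T)).2.2.2
          omega
        rw [hr] at ho hs
        refine ⟨_, r, i, a, t, T, ho, by omega, ?_⟩
        generalize (σ (T + 1)).loc p = l' at hs h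
        generalize ((σ T).loc p).line = line at hs
        cases hs <;> first | (simp only at h; omega) | (constructor; assumption) | constructor

/-- An invocation raises the rank, and the rank never decreases; so a process makes at most one
invocation at a given rank. All uniqueness of writes comes from here. -/
theorem inv_unique {s t : ℕ} {r r' : Reg} {i : Invocation (Val r)} {i' : Invocation (Val r')}
    (hs : Occurs σ s (.reg r (.inv p i))) (ht : Occurs σ t (.reg r' (.inv p i')))
    (h : ((σ s).loc p).rank = ((σ t).loc p).rank) : s = t := by
  have key : ∀ {s t : ℕ} {r : Reg} {i : Invocation (Val r)},
      Occurs σ s (.reg r (.inv p i)) → ((σ s).loc p).rank = ((σ t).loc p).rank → t ≤ s := by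
    intro s t r i hs h
    by_contra! hlt
    obtain ⟨hw, -, h1⟩ := hs.local_step_inv
    have h2 := hσ.rank_mono p (Nat.succ_le_of_lt hlt)
    simp only [Nat.succ_eq_add_one, h1] at h2
    simp [Local.rank, hw] at h2 h
    omega
  exact le_antisymm (key ht h.symm) (key hs h)

end IsExecution

/-! ### Histories of the registers -/

section Histories

variable {P V A : Type} [DecidableEq P]

theorem wellFormed_append_singleton {H : List (Event P V A)} {e : Event P V A}
    (hH : WellFormed H) (he : MayFollow H e) : WellFormed (H ++ [e]) := by
  intro G e' hG
  rcases List.prefix_concat_iff.mp hG with h | h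
  · obtain ⟨rfl, h⟩ := List.append_inj' h rfl
    obtain rfl : e' = e := by simpa using h
    exact he
  · exact hH G e' h

theorem pendingOp_append_singleton (H : List (Event P V A)) (e : Event P V A) (p : P) :
    pendingOp (H ++ [e]) p = match e with
      | .inv q i => if q = p then some i else pendingOp H p
      | .res q _ => if q = p then none else pendingOp H p
      | _ => pendingOp H p := by
  unfold pendingOp
  rw [List.foldl_append]
  rfl

end Histories

/-! ### Projection of a run to one register -/

/-- The event of the register `r` that a game event is, if it is one. -/
def GameEvent.proj (r : Reg) : GameEvent I → Option (Event (Fin n) (Val r) (I r).Act)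
  | .reg r' e => if h : r' = r then some (h ▸ e) else none
  | .flip _ _ => none
  | .idle _ => none

/-- The history of the register `r` in a run. -/
def hist (r : Reg) (L : List (GameEvent I)) : List (Event (Fin n) (Val r) (I r).Act) :=
  L.filterMap (GameEvent.proj r)

theorem proj_reg (r : Reg) (e : Event (Fin n) (Val r) (I r).Act) :
    GameEvent.proj r (.reg r e : GameEvent I) = some e := by
  simp [GameEvent.proj]

theorem proj_eq_some {r : Reg} {x : GameEvent I} {e : Event (Fin n) (Val r) (I r).Act}
    (h : x.proj r = some e) : x = .reg r e := by
  rcases x with ⟨r', e'⟩ | _ | _ <;> simp only [GameEvent.proj] at h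
  · split_ifs at h with hr
    subst hr
    simpa using h
  · cases h
  · cases h

/-- The number of events of the register `r` before time `t`. -/
def regPos (σ : ℕ → State I) (r : Reg) (t : ℕ) : ℕ := (hist r (σ t).log).length

theorem hist_succ_of_occurs {σ : ℕ → State I} {t : ℕ} {r : Reg}
    {e : Event (Fin n) (Val r) (I r).Act} (h : Occurs σ t (.reg r e)) :
    hist r (σ (t + 1)).log = hist r (σ t).log ++ [e] := by
  rw [h.log_succ, hist, List.filterMap_append]
  simp [hist, proj_reg]

namespace IsExecution

variable {σ : ℕ → State I} (hσ : IsExecution σ)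

include hσ

theorem hist_succ (r : Reg) (t : ℕ) : hist r (σ (t + 1)).log = hist r (σ t).log ∨
    ∃ e, Occurs σ t (.reg r e) ∧ hist r (σ (t + 1)).log = hist r (σ t).log ++ [e] := by
  rcases hσ.step t with h | ⟨x, hx⟩
  · exact Or.inl (by rw [h])
  · rcases hp : x.proj r with _ | e
    · refine Or.inl ?_
      rw [hx.log_succ, hist, List.filterMap_append]
      simp [hist, hp]
    · obtain rfl := proj_eq_some hp
      exact Or.inr ⟨e, hx, hist_succ_of_occurs hx⟩

theorem hist_prefix (r : Reg) {s t : ℕ} (hst : s ≤ t) :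
    hist r (σ s).log <+: hist r (σ t).log := by
  induction t, hst using Nat.le_induction with
  | base => exact List.prefix_rfl
  | succ t hst ih =>
    rcases hσ.hist_succ r t with h | ⟨e, -, h⟩
    · rwa [h]
    · rw [h]
      exact ih.trans (List.prefix_append _ _)

theorem regPos_mono (r : Reg) : Monotone (regPos σ r) := fun _ _ h => (hσ.hist_prefix r h).length_le

theorem regPos_lt {r : Reg} {s t : ℕ} {e : Event (Fin n) (Val r) (I r).Act}
    (h : Occurs σ s (.reg r e)) (hst : s < t) : regPos σ r s < regPos σ r t := by
  refine lt_of_lt_of_le ?_ (hσ.regPos_mono r (Nat.succ_le_of_lt hst))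
  simp [regPos, hist_succ_of_occurs h]

theorem lt_of_regPos_lt {r : Reg} {s t : ℕ} (h : regPos σ r s < regPos σ r t) : s < t :=
  lt_of_not_ge fun hts => h.not_ge (hσ.regPos_mono r hts)

theorem regPos_inj {r : Reg} {s t : ℕ} {e e' : Event (Fin n) (Val r) (I r).Act}
    (hs : Occurs σ s (.reg r e)) (ht : Occurs σ t (.reg r e'))
    (h : regPos σ r s = regPos σ r t) : s = t := by
  rcases lt_trichotomy s t with h1 | h1 | h1
  · exact absurd h (hσ.regPos_lt hs h1).ne
  · exact h1
  · exact absurd h.symm (hσ.regPos_lt ht h1).ne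

theorem hist_getElem? {r : Reg} {t T : ℕ} {e : Event (Fin n) (Val r) (I r).Act}
    (h : Occurs σ t (.reg r e)) (ht : t < T) : (hist r (σ T).log)[regPos σ r t]? = some e := by
  obtain ⟨R, hR⟩ := hσ.hist_prefix r (Nat.succ_le_of_lt ht)
  rw [← hR, Nat.succ_eq_add_one, hist_succ_of_occurs h, regPos]
  simp

theorem exists_occurs {r : Reg} {T k : ℕ} {e : Event (Fin n) (Val r) (I r).Act}
    (h : (hist r (σ T).log)[k]? = some e) :
    ∃ t < T, Occurs σ t (.reg r e) ∧ regPos σ r t = k := by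
  induction T with
  | zero => rw [hσ.init] at h; simp [initialState, hist] at h
  | succ T ih =>
    have old : (hist r (σ T).log)[k]? = some e →
        ∃ t < T + 1, Occurs σ t (.reg r e) ∧ regPos σ r t = k := fun h' => by
      obtain ⟨t, ht, h2⟩ := ih h'
      exact ⟨t, by omega, h2⟩
    rcases hσ.hist_succ r T with h1 | ⟨e', he', h1⟩
    · exact old (h1 ▸ h)
    · rw [h1] at h
      rcases lt_trichotomy k (hist r (σ T).log).length with hk | hk | hk
      · rw [List.getElem?_append_left hk] at h
        exact old h
      · rw [hk, List.getElem?_concat_length] at h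
        obtain rfl : e' = e := by simpa using h
        exact ⟨T, by omega, he', hk.symm⟩
      · rw [List.getElem?_eq_none (by simp; omega)] at h
        cases h

theorem foldlM_hist (r : Reg) (t : ℕ) :
    (hist r (σ t).log).foldlM (I r).next (I r).init = some ((σ t).conf r) := by
  induction t with
  | zero => rw [hσ.init]; rfl
  | succ t ih =>
    rcases hσ.step t with h | ⟨x, hx⟩
    · rw [h, ih]
    · have hlog := hx.log_succ
      obtain ⟨loc, conf, -, h2, h3⟩ := hx
      rw [hlog, hist, List.filterMap_append, List.foldlM_append]
      change (List.foldlM (I r).next (I r).init (hist r (σ t).log) >>= _) = _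
      rw [ih, h3]
      rcases x with ⟨r', e⟩ | _ | _
      · simp only [nextConf, Option.map_eq_some_iff] at h2
        obtain ⟨c, hc, rfl⟩ := h2
        by_cases hr : r' = r
        · subst hr
          simp [proj_reg, hc]
        · simp [GameEvent.proj, hr, Ne.symm hr]
      · simp only [nextConf, Option.some.injEq] at h2
        simp [List.filterMap_cons, GameEvent.proj, h2]
      · simp only [nextConf, Option.some.injEq] at h2
        simp [List.filterMap_cons, GameEvent.proj, h2]

end IsExecution

theorem ResponseStep.opAt {p : Fin n} {l l' : Local} {r : Reg} {a : Response (Val r)}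
    (h : ResponseStep p l.round l.line r a l') :
    ∃ i, opAt p l = some ⟨r, i⟩ ∧ a.Matches i ∧ l'.waiting = false := by
  obtain ⟨j, line, w⟩ := l
  simp only at h
  cases h <;> exact ⟨_, rfl, trivial, rfl⟩

namespace IsExecution

variable {σ : ℕ → State I} (hσ : IsExecution σ)

include hσ

/-- This links the flag `waiting` of the code with the pending operations of the histories;
well-formedness of the histories follows from it. -/
theorem pendingOp_hist (r : Reg) (p : Fin n) (t : ℕ) (i : Invocation (Val r)) :
    pendingOp (hist r (σ t).log) p = some i ↔
      ((σ t).loc p).waiting = true ∧ opAt p ((σ t).loc p) = some ⟨r, i⟩ := by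
  induction t generalizing i with
  | zero => rw [hσ.init]; simp [initialState, hist, pendingOp]
  | succ t ih =>
    have stutter : (σ (t + 1)).loc p = (σ t).loc p →
        pendingOp (hist r (σ (t + 1)).log) p = pendingOp (hist r (σ t).log) p →
        (pendingOp (hist r (σ (t + 1)).log) p = some i ↔ ((σ (t + 1)).loc p).waiting = true ∧
          opAt p ((σ (t + 1)).loc p) = some ⟨r, i⟩) := fun h1 h2 => by rw [h1, h2, ih]
    rcases hσ.step t with h | ⟨x, hx⟩
    · exact stutter (by rw [h]) (by rw [h])
    · rcases hp : x.proj r with _ | e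
      · have h1 : hist r (σ (t + 1)).log = hist r (σ t).log := by
          rw [hx.log_succ, hist, List.filterMap_append]
          simp [hist, hp]
        rcases hx.local_step p with h2 | h2
        · exact stutter h2 (by rw [h1])
        -- The event changes the state of `p` without being an event of `r`: no operation on `r` is
        -- pending before or after.
        · rw [h1, ih]
          cases h2 with
          | inv r' i' hw ho h' =>
            have h3 : opAt p ((σ (t + 1)).loc p) = some ⟨r', i'⟩ := by rw [h', ← ho]; rfl
            rw [h3, hw, ho]
            have : r' ≠ r := by rintro rfl; simp [proj_reg] at hp
            simp [this]
          | res r' a hw h' =>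
            obtain ⟨i', h3, -, h4⟩ := (responseStep_of_afterResponse h').opAt
            rw [h3, h4]
            have : r' ≠ r := by rintro rfl; simp [proj_reg] at hp
            simp [this]
          | flip c hl h' =>
            rw [h']
            obtain ⟨h3, h4⟩ := hx.local_step_flip
            have h5 : ((σ t).loc p).waiting = false := by
              by_contra hw
              rw [Bool.not_eq_false] at hw
              obtain ⟨s, -, r', i', -, -, h6, -⟩ := hσ.exists_inv_of_waiting p
                (T := t) (j := ((σ t).loc p).round) (line := .hFlip) (by rw [← h3, ← hw])
              simp [opAt] at h6
            simp [h5]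
      · obtain rfl := proj_eq_some hp
        have h1 := hist_succ_of_occurs hx
        rcases e with ⟨q, i'⟩ | ⟨q, a⟩ | ⟨q, a⟩ | a
        · by_cases hq : q = p
          · subst hq
            obtain ⟨h2, h3, h4⟩ := hx.local_step_inv
            have h5 : opAt q ((σ (t + 1)).loc q) = some ⟨r, i'⟩ := by rw [h4, ← h3]; rfl
            rw [h1, pendingOp_append_singleton, h5, h4]
            simp
          · refine stutter ?_ ?_
            · rcases hx.local_step p with h2 | h2
              · exact h2
              · cases h2; exact absurd rfl hq
            · rw [h1, pendingOp_append_singleton]; simp [hq]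
        · by_cases hq : q = p
          · subst hq
            obtain ⟨h2, h3⟩ := hx.local_step_res
            obtain ⟨i', -, -, h4⟩ := (responseStep_of_afterResponse h3).opAt
            rw [h1, pendingOp_append_singleton, h4]
            simp
          · refine stutter ?_ ?_
            · rcases hx.local_step p with h2 | h2
              · exact h2
              · cases h2; exact absurd rfl hq
            · rw [h1, pendingOp_append_singleton]; simp [hq]
        · refine stutter ?_ ?_
          · rcases hx.local_step p with h2 | h2
            · exact h2
            · cases h2
          · rw [h1, pendingOp_append_singleton]
        · refine stutter ?_ ?_
          · rcases hx.local_step p with h2 | h2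
            · exact h2
            · cases h2
          · rw [h1, pendingOp_append_singleton]

theorem wellFormed_hist (r : Reg) (t : ℕ) : WellFormed (hist r (σ t).log) := by
  induction t with
  | zero =>
    rw [hσ.init]
    intro G e h
    simp [initialState, hist] at h
  | succ t ih =>
    rcases hσ.hist_succ r t with h | ⟨e, he, h⟩
    · rwa [h]
    · rw [h]
      refine wellFormed_append_singleton ih ?_
      rcases e with ⟨p, i⟩ | ⟨p, a⟩ | ⟨p, a⟩ | a
      · obtain ⟨h1, -, -⟩ := he.local_step_inv
        rw [MayFollow, Option.eq_none_iff_forall_ne_some]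
        intro i' h2
        have := ((hσ.pendingOp_hist r p t i').mp h2).1
        simp [h1] at this
      · obtain ⟨h1, h2⟩ := he.local_step_res
        obtain ⟨i, h3, h4, -⟩ := (responseStep_of_afterResponse h2).opAt
        exact ⟨i, (hσ.pendingOp_hist r p t i).mpr ⟨h1, h3⟩, h4⟩
      · obtain ⟨loc, conf, h1, -, -⟩ := he
        simp only [nextLoc, Option.ite_none_right_eq_some, Option.map_eq_some_iff] at h1
        obtain ⟨⟨hw, ⟨r', i⟩, ho, hr⟩, -⟩ := h1
        obtain rfl : r' = r := hr
        rw [MayFollow, (hσ.pendingOp_hist r' p t i).mpr ⟨hw, ho⟩]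
        simp
      · trivial

/-- Through this membership the hypotheses on the implementations apply to the game. -/
theorem hist_mem_histories (r : Reg) (t : ℕ) : hist r (σ t).log ∈ (I r).histories :=
  ⟨hσ.wellFormed_hist r t, by rw [hσ.foldlM_hist]; rfl⟩

theorem responseAt_of_opDone {p : Fin n} {j : ℕ} {line : Line} {r : Reg} {i : Invocation (Val r)}
    {a : Response (Val r)} {t m T : ℕ} (h : OpDone σ p j line r i a t m) (hm : m < T) :
    ResponseAt (hist r (σ T).log) (regPos σ r t) (regPos σ r m) a := by
  refine ⟨p, i, hσ.hist_getElem? h.inv (h.lt.trans hm), hσ.regPos_lt h.inv h.lt,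
    hσ.hist_getElem? h.res hm, fun l h1 h2 a' h3 => ?_⟩
  obtain ⟨s, -, hs, rfl⟩ := hσ.exists_occurs h3
  have hts := hσ.lt_of_regPos_lt h1
  have hsm := hσ.lt_of_regPos_lt h2
  obtain ⟨-, h4⟩ := hs.local_step_res
  -- A response in between would end the waiting of `p`, which lasts until `m`.
  obtain ⟨-, -, -, h5⟩ := (responseStep_of_afterResponse h4).opAt
  rw [h.loc_wait (s + 1) (by omega) (by omega)] at h5
  simp at h5

end IsExecution

/-! ### The order of a linearization -/

section Lists

variable {P V : Type}

theorem Legal.head_cases {v : V} {o : SeqOp P V} {S : List (SeqOp P V)} (h : Legal v (o :: S)) :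
    (o.inv = .read ∧ o.res = .value v ∧ Legal v S) ∨ ∃ w, o.inv = .write w ∧ Legal w S := by
  obtain ⟨k, p, i, a⟩ := o
  rcases i with _ | w <;> rcases a with u | _ <;> simp only [Legal] at h
  · exact Or.inl ⟨rfl, by rw [h.1], h.2⟩
  · exact Or.inr ⟨w, rfl, h⟩

/-- Here `v` is the value held on entering the list. Applied to the part of a history after a given
write, with `v` the value of that write, it yields `Legal.exists_write`. -/
theorem Legal.exists_write_or {v u : V} {o : SeqOp P V} {S : List (SeqOp P V)} {a : ℕ}
    (h : Legal v S) (ha : S[a]? = some o) (hi : o.inv = .read) (hr : o.res = .value u) :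
    u = v ∨ ∃ c < a, ∃ o', S[c]? = some o' ∧ o'.inv = .write u := by
  induction S generalizing v a with
  | nil => simp at ha
  | cons x S ih =>
    rcases a with _ | a
    · obtain rfl : x = o := by simpa using ha
      rcases h.head_cases with ⟨-, h2, -⟩ | ⟨w, h2, -⟩
      · rw [hr] at h2
        exact Or.inl (by simpa using h2)
      · rw [hi] at h2; cases h2
    · rw [List.getElem?_cons_succ] at ha
      have key : ∀ w, Legal w S → (u = w → u = v ∨ x.inv = .write u) →
          u = v ∨ ∃ c < a + 1, ∃ o', (x :: S)[c]? = some o' ∧ o'.inv = .write u := by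
        intro w hw himp
        rcases ih hw ha with h3 | ⟨c, hc, o', h3, h4⟩
        · exact (himp h3).imp_right fun h4 => ⟨0, by omega, x, rfl, h4⟩
        · exact Or.inr ⟨c + 1, by omega, o', by simpa using h3, h4⟩
      rcases h.head_cases with ⟨-, -, h3⟩ | ⟨w, h2, h3⟩
      · exact key v h3 Or.inl
      · exact key w h3 fun huw => Or.inr (huw ▸ h2)

/-- A read returns a value written since any given write before it. -/
theorem Legal.exists_write {v u w : V} {o x : SeqOp P V} {S : List (SeqOp P V)} {a b : ℕ}
    (h : Legal v S) (ha : S[a]? = some o) (hi : o.inv = .read) (hr : o.res = .value u)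
    (hb : S[b]? = some x) (hx : x.inv = .write w) (hba : b < a) :
    ∃ c, b ≤ c ∧ c < a ∧ ∃ o', S[c]? = some o' ∧ o'.inv = .write u := by
  induction S generalizing v a b with
  | nil => simp at ha
  | cons y S ih =>
    obtain ⟨a, rfl⟩ := Nat.exists_eq_add_of_lt hba
    rw [List.getElem?_cons_succ] at ha
    rcases b with _ | b
    · obtain rfl : y = x := by simpa using hb
      rcases h.head_cases with ⟨h2, -, -⟩ | ⟨w', h2, h3⟩
      · rw [hx] at h2; cases h2
      · rcases h3.exists_write_or ha hi hr with h4 | ⟨c, hc, o', h4, h5⟩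
        · exact ⟨0, le_rfl, by omega, y, rfl, h4 ▸ h2⟩
        · exact ⟨c + 1, by omega, by omega, o', by simpa using h4, h5⟩
    · have key : ∀ v, Legal v S → ∃ c, b + 1 ≤ c ∧ c < b + 1 + a + 1 ∧
          ∃ o', (y :: S)[c]? = some o' ∧ o'.inv = .write u := fun v h3 => by
        rw [List.getElem?_cons_succ] at hb
        obtain ⟨c, h4, h5, o', h6, h7⟩ := ih h3 ha hb (by omega)
        exact ⟨c + 1, by omega, by omega, o', by simpa using h6, h7⟩
      rcases h.head_cases with ⟨-, -, h3⟩ | ⟨w', -, h3⟩ <;> exact key _ h3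

/-- In `S`, a write of `x` comes before a write of `y`. -/
def WrittenBefore (S : List (SeqOp P V)) (x y : V) : Prop :=
  ∃ o o', List.Sublist [o, o'] (S.filter SeqOp.isWrite) ∧ o.inv = .write x ∧ o'.inv = .write y

/-- In `S`, the value `x` is written at most once. -/
def WrittenOnce (S : List (SeqOp P V)) (x : V) : Prop :=
  ∀ o ∈ S, ∀ o' ∈ S, o.inv = .write x → o'.inv = .write x → o = o'

theorem WrittenBefore.mono {S S' : List (SeqOp P V)} {x y : V} (h : WrittenBefore S x y)
    (hS : S.filter SeqOp.isWrite <+: S'.filter SeqOp.isWrite) : WrittenBefore S' x y := by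
  obtain ⟨o, o', h1, h2⟩ := h
  exact ⟨o, o', h1.trans hS.sublist, h2⟩

/-- If `y` is already written in a prefix, then so is all that is written before it. -/
theorem WrittenBefore.of_prefix {S S' : List (SeqOp P V)} {x y : V} (h : WrittenBefore S' x y)
    (hS : S.filter SeqOp.isWrite <+: S'.filter SeqOp.isWrite) (hn : S'.Nodup)
    (hy : WrittenOnce S' y) (hyS : ∃ o ∈ S, o.inv = .write y) : WrittenBefore S x y := by
  obtain ⟨o, o', h1, h2, h3⟩ := h
  obtain ⟨R, hR⟩ := hS
  refine ⟨o, o', ?_, h2, h3⟩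
  have ho' : o' ∈ S' := List.mem_of_mem_filter (h1.subset (by simp : o' ∈ [o, o']))
  rw [← hR] at h1
  obtain ⟨l₁, l₂, h4, h5, h6⟩ := List.sublist_append_iff.mp h1
  -- Either the pair lies in the shorter list, or its second member lies in the extension; then `y`
  -- would be written both there and in the prefix.
  rcases List.eq_nil_or_concat l₂ with rfl | ⟨l₃, z, rfl⟩
  · rw [h4, List.append_nil]; exact h5
  · exfalso
    have hz : o' = z := by
      have := congrArg List.getLast? h4
      simpa using this
    have hzR : o' ∈ R := h6.subset (by simp [hz])
    obtain ⟨y', hy1, hy2⟩ := hyS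
    have hyP : y' ∈ S.filter SeqOp.isWrite :=
      List.mem_filter.mpr ⟨hy1, by simp [SeqOp.isWrite, hy2]⟩
    have hyQ : y' ∈ S' := by
      refine List.mem_of_mem_filter (p := SeqOp.isWrite) ?_
      rw [← hR]
      exact List.mem_append_left _ hyP
    have := hn.filter SeqOp.isWrite
    rw [← hR, List.nodup_append] at this
    exact this.2.2 y' hyP o' hzR (hy y' hyQ o' ho' hy2 h3)

theorem not_sublist_swap {α : Type} {a b : α} {l : List α} (hl : l.Nodup)
    (h : List.Sublist [a, b] l) : ¬ List.Sublist [b, a] l := by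
  induction l with
  | nil => simp at h
  | cons x l ih =>
    rw [List.nodup_cons] at hl
    intro h'
    cases h with
    | cons _ h1 =>
      cases h' with
      | cons _ h2 => exact ih hl.2 h1 h2
      | cons_cons _ h2 => exact hl.1 (h1.subset (by simp))
    | cons_cons _ h1 =>
      cases h' with
      | cons _ h2 => exact hl.1 (h2.subset (by simp))
      | cons_cons _ h2 => exact hl.1 (by simpa using h1)

theorem WrittenBefore.asymm {S : List (SeqOp P V)} {x y : V} (h : WrittenBefore S x y)
    (hn : S.Nodup) (hx : WrittenOnce S x) (hy : WrittenOnce S y) : ¬ WrittenBefore S y x := by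
  rintro ⟨b', a', h1, h2, h3⟩
  obtain ⟨a, b, h4, h5, h6⟩ := h
  have mem : ∀ {z : SeqOp P V} {l : List (SeqOp P V)}, List.Sublist l (S.filter SeqOp.isWrite) →
      z ∈ l → z ∈ S := fun hl hz => List.mem_of_mem_filter (hl.subset hz)
  obtain rfl := hx a (mem h4 (by simp)) a' (mem h1 (by simp)) h5 h3
  obtain rfl := hy b (mem h4 (by simp)) b' (mem h1 (by simp)) h6 h2
  exact not_sublist_swap (hn.filter _) h4 h1

end Lists

/-- The position, in the linearization `S`, of the operation on `r` invoked at time `t`; the length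
of `S` if there is none. -/
def linPos (σ : ℕ → State I) (r : Reg) (S : List (SeqOp (Fin n) (Val r))) (t : ℕ) : ℕ :=
  (S.map SeqOp.pos).idxOf (regPos σ r t)

/-- `ord` orders the operations on `r` before time `T` like a linearization. -/
structure IsLinearOrder (σ : ℕ → State I) (r : Reg) (T : ℕ) (ord : ℕ → ℕ) : Prop where
  order : ∀ {p j line i a t m p' i' t'}, OpDone σ p j line r i a t m → m < T →
    Occurs σ t' (.reg r (.inv p' i')) → t' < T → m < t' → ord t < ord t'
  read : ∀ {p j line v t m p₀ w t₀}, OpDone σ p j line r .read (.value v) t m → m < T →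
    Occurs σ t₀ (.reg r (.inv p₀ (.write w))) → t₀ < T → ord t₀ < ord t →
    ∃ t₁ < T, ∃ p₁, Occurs σ t₁ (.reg r (.inv p₁ (.write v))) ∧ ord t₀ ≤ ord t₁ ∧ ord t₁ < ord t

/-- An operation linearized before another one is invoked before the latter is answered. -/
theorem IsLinearOrder.lt_of_lt {σ : ℕ → State I} {r : Reg} {T : ℕ} {ord : ℕ → ℕ}
    (h : IsLinearOrder σ r T ord) {p p' : Fin n} {j : ℕ} {line : Line} {i i' : Invocation (Val r)}
    {a : Response (Val r)} {t t' m : ℕ} (ho : OpDone σ p j line r i a t m) (hm : m < T)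
    (ho' : Occurs σ t' (.reg r (.inv p' i'))) (ht' : t' < T) (hlt : ord t' < ord t) : t' < m := by
  by_contra! hle
  rcases hle.eq_or_lt with rfl | hlt'
  · have := ho.res.unique ho'
    simp at this
  · exact (h.order ho hm ho' ht' hlt').not_gt hlt

namespace IsExecution

variable {σ : ℕ → State I} (hσ : IsExecution σ) {r : Reg} {T : ℕ} {v₀ : Val r}
  {S : List (SeqOp (Fin n) (Val r))} (hS : IsLinearization v₀ (hist r (σ T).log) S)

theorem getElem?_linPos {t : ℕ} (h : linPos σ r S t < S.length) :
    ∃ o, S[linPos σ r S t]? = some o ∧ o.pos = regPos σ r t := by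
  refine ⟨_, List.getElem?_eq_getElem h, ?_⟩
  have h1 : linPos σ r S t < (S.map SeqOp.pos).length := by simpa using h
  have h2 := List.getElem_idxOf h1
  exact (List.getElem_map SeqOp.pos).symm.trans h2

include hS

theorem linPos_eq {k t : ℕ} {o : SeqOp (Fin n) (Val r)} (hk : S[k]? = some o)
    (ho : o.pos = regPos σ r t) : linPos σ r S t = k := by
  have hk' : (S.map SeqOp.pos)[k]? = some (regPos σ r t) := by simp [hk, ho]
  obtain ⟨h1, h2⟩ := List.getElem?_eq_some_iff.mp hk'
  rw [linPos, ← h2]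
  exact hS.once.idxOf_getElem k h1

include hσ

theorem inv_eq {t : ℕ} {p : Fin n} {i : Invocation (Val r)} {o : SeqOp (Fin n) (Val r)}
    (ht : Occurs σ t (.reg r (.inv p i))) (htT : t < T) (ho : o ∈ S) (h : o.pos = regPos σ r t) :
    o.inv = i := by
  have h1 := hS.invoked o ho
  rw [h, hσ.hist_getElem? ht htT] at h1
  simpa using (Event.inv.inj (Option.some.inj h1)).2.symm

theorem exists_of_mem {o : SeqOp (Fin n) (Val r)} (ho : o ∈ S) :
    ∃ t < T, Occurs σ t (.reg r (.inv o.proc o.inv)) ∧ regPos σ r t = o.pos :=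
  hσ.exists_occurs (hS.invoked o ho)

theorem exists_linearized {p : Fin n} {j : ℕ} {line : Line} {i : Invocation (Val r)}
    {a : Response (Val r)} {t m : ℕ} (h : OpDone σ p j line r i a t m) (hm : m < T) :
    ∃ o, S[linPos σ r S t]? = some o ∧ o.inv = i ∧ o.res = a := by
  obtain ⟨o, ho, h1, h2⟩ := hS.complete _ _ _ (hσ.responseAt_of_opDone h hm)
  obtain ⟨k, hk⟩ := List.mem_iff_getElem?.mp ho
  rw [linPos_eq hS hk h1]
  exact ⟨o, hk, hσ.inv_eq hS h.inv (h.lt.trans hm) ho h1, h2⟩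

/-- Operations without a place in `S` get its length, beyond all places. So `order` holds for
pending operations too, and in `read` the assumption `ord t₀ < ord t` implies that the write is
linearized. -/
theorem isLinearOrder_linPos : IsLinearOrder σ r T (linPos σ r S) where
  order {p j line i a t m p' i' t'} h hm h' ht' hmt := by
    obtain ⟨o, ho, -, -⟩ := hσ.exists_linearized hS h hm
    have hlt : linPos σ r S t < S.length := (List.getElem?_eq_some_iff.mp ho).1
    by_contra! hle
    obtain ⟨o', ho', hp'⟩ := getElem?_linPos (hle.trans_lt hlt)
    obtain ⟨o₁, ho₁, hp⟩ := getElem?_linPos hlt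
    obtain ⟨hl, hl1⟩ := List.getElem?_eq_some_iff.mp ho₁
    obtain ⟨hl', hl1'⟩ := List.getElem?_eq_some_iff.mp ho'
    rcases hle.eq_or_lt with heq | hlt'
    · have : o' = o₁ := by rw [heq] at ho'; exact Option.some.inj (ho'.symm.trans ho₁)
      have h1 : regPos σ r t < regPos σ r t' := hσ.regPos_lt h.inv (h.lt.trans hmt)
      rw [← hp, ← hp', this] at h1
      exact lt_irrefl _ h1
    · have := List.pairwise_iff_getElem.mp hS.order _ _ hl' hl hlt'
      rw [hl1, hl1', hp, hp'] at this
      exact this ⟨_, a, hσ.responseAt_of_opDone h hm, hσ.regPos_lt h.res hmt⟩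
  read {p j line v t m p₀ w t₀} h hm h₀ ht₀ hlt := by
    obtain ⟨o, ho, hi, ha⟩ := hσ.exists_linearized hS h hm
    have hlen : linPos σ r S t < S.length := (List.getElem?_eq_some_iff.mp ho).1
    obtain ⟨o', ho', hp'⟩ := getElem?_linPos (hlt.trans hlen)
    have hi' := hσ.inv_eq hS h₀ ht₀ (List.mem_of_getElem? ho') hp'
    obtain ⟨c, hc1, hc2, x, hx, hxi⟩ := hS.legal.exists_write ho hi ha ho' hi' hlt
    obtain ⟨t₁, ht₁, h1, h2⟩ := hσ.exists_of_mem hS (List.mem_of_getElem? hx)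
    rw [hxi] at h1
    refine ⟨t₁, ht₁, x.proc, h1, ?_⟩
    rw [linPos_eq hS hx h2.symm]
    exact ⟨hc1, hc2⟩

theorem writtenBefore {t t' : ℕ} {p p' : Fin n} {x y : Val r}
    (ht : Occurs σ t (.reg r (.inv p (.write x)))) (htT : t < T)
    (ht' : Occurs σ t' (.reg r (.inv p' (.write y)))) (htT' : t' < T) (hne : t ≠ t')
    (hle : linPos σ r S t ≤ linPos σ r S t') (hlt : linPos σ r S t' < S.length) :
    WrittenBefore S x y := by
  obtain ⟨o, ho, hp⟩ := getElem?_linPos (hle.trans_lt hlt)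
  obtain ⟨o', ho', hp'⟩ := getElem?_linPos hlt
  have hi := hσ.inv_eq hS ht htT (List.mem_of_getElem? ho) hp
  have hi' := hσ.inv_eq hS ht' htT' (List.mem_of_getElem? ho') hp'
  refine ⟨o, o', ?_, hi, hi'⟩
  have hlt' : linPos σ r S t < linPos σ r S t' := by
    refine lt_of_le_of_ne hle fun heq => hne (hσ.regPos_inj ht ht' ?_)
    rw [heq] at ho
    rw [← hp, ← hp', Option.some.inj (ho.symm.trans ho')]
  have hsub : List.Sublist [o, o'] S := by
    obtain ⟨h1, h2⟩ := List.getElem?_eq_some_iff.mp ho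
    obtain ⟨h3, h4⟩ := List.getElem?_eq_some_iff.mp ho'
    rw [← List.take_append_drop (linPos σ r S t') S]
    refine List.Sublist.append (l₁ := [o]) (r₁ := [o']) ?_ ?_
    · rw [List.singleton_sublist, ← h2]
      exact List.mem_take_iff_getElem.mpr ⟨_, by omega, rfl⟩
    · rw [List.singleton_sublist, List.drop_eq_getElem_cons h3, h4]
      simp
  simpa [SeqOp.isWrite, hi, hi'] using hsub.filter SeqOp.isWrite

theorem writtenOnce {x : Val r} (hx : ∀ {t t' p p'}, Occurs σ t (.reg r (.inv p (.write x))) →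
    Occurs σ t' (.reg r (.inv p' (.write x))) → t = t') : WrittenOnce S x := by
  intro o ho o' ho' hi hi'
  obtain ⟨t, -, h1, h2⟩ := hσ.exists_of_mem hS ho
  obtain ⟨t', -, h1', h2'⟩ := hσ.exists_of_mem hS ho'
  rw [hi] at h1
  rw [hi'] at h1'
  have := hx h1 h1'
  subst this
  exact List.inj_on_of_nodup_map hS.once ho ho' (h2.symm.trans h2')

end IsExecution

/-! ### Operations of one process -/

theorem idx_loopStart (p : Fin n) : (loopStart p).idx = 0 := by
  unfold loopStart
  split_ifs <;> rfl

/-- The process is past the tests of its round `j`. -/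
def Local.Passed (l : Local) (j : ℕ) : Prop :=
  j < l.round ∨ l.round = j ∧ 5 ≤ l.line.idx ∧ l.line.idx ≤ 7

/-- At time `t`, the player `q` invokes the write of the counter value `v` in its round `j`. -/
structure IsIncrement (σ : ℕ → State I) (q : Fin n) (j v t : ℕ) : Prop where
  inv : Occurs σ t (.reg .R2 (.inv q (.write v)))
  loc : (σ t).loc q = ⟨j, .pWriteR2 v, false⟩

theorem IsIncrement.passed {σ : ℕ → State I} {q : Fin n} {j v t : ℕ} (h : IsIncrement σ q j v t) :
    ((σ t).loc q).Passed j := by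
  rw [h.loc]
  exact Or.inr ⟨rfl, by simp [Line.idx]⟩

namespace IsExecution

variable {σ : ℕ → State I} (hσ : IsExecution σ) {p : Fin n}

include hσ

/-- The value reveals its writer and the round, which makes the write unique (`write_R1_unique`). -/
theorem write_R1 {t j : ℕ} {i : Fin 2} (h : Occurs σ t (.reg .R1 (.inv p (.write (some (i, j)))))) :
    (σ t).loc p = ⟨j, .hWriteR1, false⟩ ∧ p.val = i.val := by
  obtain ⟨h1, h2, -⟩ := h.local_step_inv
  have h3 := hσ.line_of p t
  generalize (σ t).loc p = l at *
  obtain ⟨j', line, w⟩ := l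
  cases line <;> simp [opAt, Line.Of] at h1 h2 h3
  obtain ⟨h2, rfl⟩ := h2
  refine ⟨by rw [h1], ?_⟩
  rw [← h2]
  split_ifs with h0
  · exact h0
  · change p.val = 1; omega

theorem write_C {t : ℕ} {c : Fin 2} (h : Occurs σ t (.reg .C (.inv p (.write (some c))))) :
    (∃ j, (σ t).loc p = ⟨j, .hWriteC c, false⟩) ∧ p.val = 0 := by
  obtain ⟨h1, h2, -⟩ := h.local_step_inv
  have h3 := hσ.line_of p t
  generalize (σ t).loc p = l at *
  obtain ⟨j', line, w⟩ := l
  cases line <;> simp [opAt, Line.Of] at h1 h2 h3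
  exact ⟨⟨j', by rw [h1, h2]⟩, h3⟩

/-- Positivity matters: `0` is written by every reset, so it tells nothing about its writer. -/
theorem isIncrement_of_write {t v : ℕ} (hv : 1 ≤ v)
    (h : Occurs σ t (.reg .R2 (.inv p (.write v)))) :
    (∃ j, IsIncrement σ p j v t) ∧ 2 ≤ p.val := by
  obtain ⟨h1, h2, -⟩ := h.local_step_inv
  have h3 := hσ.line_of p t
  suffices (∃ j, (σ t).loc p = ⟨j, .pWriteR2 v, false⟩) ∧ 2 ≤ p.val from
    ⟨this.1.imp fun j hj => ⟨h, hj⟩, this.2⟩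
  clear h
  generalize (σ t).loc p = l at *
  obtain ⟨j', line, w⟩ := l
  cases line <;> simp [opAt, Line.Of] at h1 h2 h3
  · change (0 : ℕ) = v at h2; omega
  · change (0 : ℕ) = v at h2; omega
  · exact ⟨⟨j', by rw [h1, h2]⟩, h3⟩

theorem increment_unique {j v v' t t' : ℕ} (h : IsIncrement σ p j v t)
    (h' : IsIncrement σ p j v' t') : t = t' ∧ v = v' := by
  have ht : t = t' := hσ.inv_unique p h.inv h'.inv (by rw [h.loc, h'.loc]; rfl)
  subst ht
  have := h.loc.symm.trans h'.loc
  simp at this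
  exact ⟨rfl, this⟩

/-- This and the next lemmas trace a process back through its round: each location considered has
exactly one predecessor in the code. -/
theorem exists_opDone_pWriteR2 {T j w : ℕ} (h : (σ T).loc p = ⟨j, .pWriteR2 w, false⟩) :
    ∃ v t m, OpDone σ p j .pReadR2 .R2 .read (.value v) t m ∧ m < T ∧ w = v + 1 := by
  have hl := idx_loopStart p
  rcases hσ.exists_pred p h with ⟨-, h1⟩ | ⟨c, h1, -⟩ | ⟨j', line', r, i, a, t, m, ho, hm, hs⟩
  · rw [← h1] at hl
    simp [Line.idx] at hl
  · cases h1
  -- The target is generalized because `loopStart p` is not a constructor; transitions into a new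
  -- round are then excluded by `idx`, which is `0` at `loopStart p`.
  · generalize hl' : (⟨j, .pWriteR2 w, false⟩ : Local) = l' at hs
    cases hs <;> first
      | (have := congrArg (fun l => l.line.idx) hl'
         simp only [hl] at this
         simp [Line.idx] at this
         done)
      | (cases hl'
         done)
      | skip
    cases hl'
    have := ho.op
    simp only [opAt, Option.some.injEq, Sigma.mk.injEq, heq_eq_eq, true_and] at this
    subst this
    exact ⟨_, t, m, ho, hm, rfl⟩

theorem exists_opDone_pReadR2 {T j : ℕ} (h : (σ T).loc p = ⟨j, .pReadR2, false⟩) :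
    ∃ t m, OpDone σ p j .pResetR2 .R2 (.write (0 : ℕ)) .ack t m ∧ m < T := by
  have hl := idx_loopStart p
  rcases hσ.exists_pred p h with ⟨-, h1⟩ | ⟨c, h1, -⟩ | ⟨j', line', r, i, a, t, m, ho, hm, hs⟩
  · rw [← h1] at hl
    simp [Line.idx] at hl
  · cases h1
  · generalize hl' : (⟨j, .pReadR2, false⟩ : Local) = l' at hs
    cases hs <;> first
      | (have := congrArg (fun l => l.line.idx) hl'
         simp only [hl] at this
         simp [Line.idx] at this)
      | (cases hl'
         done)
      | skip
    cases hl'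
    have := ho.op
    simp only [opAt, Option.some.injEq, Sigma.mk.injEq, heq_eq_eq, true_and] at this
    subst this
    exact ⟨t, m, ho, hm⟩

theorem exists_opDone_pResetR2 {T j : ℕ} (h : (σ T).loc p = ⟨j, .pResetR2, false⟩) :
    ∃ c t m, OpDone σ p j (.pReadC (some (c, j)) (some (1 - c, j))) .C .read (.value (some c)) t m ∧
      m < T := by
  have hl := idx_loopStart p
  rcases hσ.exists_pred p h with ⟨-, h1⟩ | ⟨c, h1, -⟩ | ⟨j', line', r, i, a, t, m, ho, hm, hs⟩
  · rw [← h1] at hl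
    simp [Line.idx] at hl
  · cases h1
  · generalize hl' : (⟨j, .pResetR2, false⟩ : Local) = l' at hs
    cases hs <;> first
      | (have := congrArg (fun l => l.line.idx) hl'
         simp only [hl] at this
         simp [Line.idx] at this)
      | (cases hl'
         done)
      | skip
    cases hl'
    have := ho.op
    simp only [opAt, Option.some.injEq, Sigma.mk.injEq, heq_eq_eq, true_and] at this
    subst this
    exact ⟨_, t, m, ho, hm⟩

theorem exists_opDone_pReadC {T j : ℕ} {u₁ u₂ : Option (Fin 2 × ℕ)}
    (h : (σ T).loc p = ⟨j, .pReadC u₁ u₂, false⟩) :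
    ∃ t m, OpDone σ p j (.pReadSecond u₁) .R1 .read (.value u₂) t m ∧ m < T := by
  have hl := idx_loopStart p
  rcases hσ.exists_pred p h with ⟨-, h1⟩ | ⟨c, h1, -⟩ | ⟨j', line', r, i, a, t, m, ho, hm, hs⟩
  · rw [← h1] at hl
    simp [Line.idx] at hl
  · cases h1
  · generalize hl' : (⟨j, .pReadC u₁ u₂, false⟩ : Local) = l' at hs
    cases hs <;> first
      | (have := congrArg (fun l => l.line.idx) hl'
         simp only [hl] at this
         simp [Line.idx] at this
         done)
      | (cases hl'
         done)
      | skip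
    cases hl'
    have := ho.op
    simp only [opAt, Option.some.injEq, Sigma.mk.injEq, heq_eq_eq, true_and] at this
    subst this
    exact ⟨t, m, ho, hm⟩

theorem exists_opDone_pReadSecond {T j : ℕ} {u₁ : Option (Fin 2 × ℕ)}
    (h : (σ T).loc p = ⟨j, .pReadSecond u₁, false⟩) :
    ∃ t m, OpDone σ p j .pReadFirst .R1 .read (.value u₁) t m ∧ m < T := by
  have hl := idx_loopStart p
  rcases hσ.exists_pred p h with ⟨-, h1⟩ | ⟨c, h1, -⟩ | ⟨j', line', r, i, a, t, m, ho, hm, hs⟩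
  · rw [← h1] at hl
    simp [Line.idx] at hl
  · cases h1
  · generalize hl' : (⟨j, .pReadSecond u₁, false⟩ : Local) = l' at hs
    cases hs <;> first
      | (have := congrArg (fun l => l.line.idx) hl'
         simp only [hl] at this
         simp [Line.idx] at this
         done)
      | (cases hl'
         done)
      | skip
    cases hl'
    have := ho.op
    simp only [opAt, Option.some.injEq, Sigma.mk.injEq, heq_eq_eq, true_and] at this
    subst this
    exact ⟨t, m, ho, hm⟩

theorem exists_opDone_pReadFirst {T j : ℕ} (h : (σ T).loc p = ⟨j, .pReadFirst, false⟩) :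
    ∃ t m, OpDone σ p j .pResetC .C (.write none) .ack t m ∧ m < T := by
  have hl := idx_loopStart p
  rcases hσ.exists_pred p h with ⟨-, h1⟩ | ⟨c, h1, -⟩ | ⟨j', line', r, i, a, t, m, ho, hm, hs⟩
  · rw [← h1] at hl
    simp [Line.idx] at hl
  · cases h1
  · generalize hl' : (⟨j, .pReadFirst, false⟩ : Local) = l' at hs
    cases hs <;> first
      | (have := congrArg (fun l => l.line.idx) hl'
         simp only [hl] at this
         simp [Line.idx] at this)
      | (cases hl'
         done)
      | skip
    cases hl'
    have := ho.op
    simp only [opAt, Option.some.injEq, Sigma.mk.injEq, heq_eq_eq, true_and] at this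
    subst this
    exact ⟨t, m, ho, hm⟩

theorem exists_opDone_pResetC {T j : ℕ} (h : (σ T).loc p = ⟨j, .pResetC, false⟩) :
    ∃ t m, OpDone σ p j .pResetR1 .R1 (.write none) .ack t m ∧ m < T := by
  have hl := idx_loopStart p
  rcases hσ.exists_pred p h with ⟨-, h1⟩ | ⟨c, h1, -⟩ | ⟨j', line', r, i, a, t, m, ho, hm, hs⟩
  · rw [← h1] at hl
    simp [Line.idx] at hl
  · cases h1
  · generalize hl' : (⟨j, .pResetC, false⟩ : Local) = l' at hs
    cases hs <;> first
      | (have := congrArg (fun l => l.line.idx) hl'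
         simp only [hl] at this
         simp [Line.idx] at this
         done)
      | (cases hl'
         done)
      | skip
    cases hl'
    have := ho.op
    simp only [opAt, Option.some.injEq, Sigma.mk.injEq, heq_eq_eq, true_and] at this
    subst this
    exact ⟨t, m, ho, hm⟩

theorem exists_opDone_hReadR2 {T j : ℕ} (h : (σ T).loc p = ⟨j, .hReadR2, false⟩) :
    ∃ t m, OpDone σ p j .hResetR2 .R2 (.write (0 : ℕ)) .ack t m ∧ m < T := by
  have hl := idx_loopStart p
  rcases hσ.exists_pred p h with ⟨-, h1⟩ | ⟨c, h1, -⟩ | ⟨j', line', r, i, a, t, m, ho, hm, hs⟩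
  · rw [← h1] at hl
    simp [Line.idx] at hl
  · cases h1
  · generalize hl' : (⟨j, .hReadR2, false⟩ : Local) = l' at hs
    cases hs <;> first
      | (have := congrArg (fun l => l.line.idx) hl'
         simp only [hl] at this
         simp [Line.idx] at this
         done)
      | (cases hl'
         done)
      | skip
    cases hl'
    have := ho.op
    simp only [opAt, Option.some.injEq, Sigma.mk.injEq, heq_eq_eq, true_and] at this
    subst this
    exact ⟨t, m, ho, hm⟩

theorem exists_opDone_hFlip {T j : ℕ} (h : (σ T).loc p = ⟨j, .hFlip, false⟩) :
    ∃ t m, OpDone σ p j .hWriteR1 .R1 (.write (some (0, j))) .ack t m ∧ m < T := by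
  have hl := idx_loopStart p
  rcases hσ.exists_pred p h with ⟨-, h1⟩ | ⟨c, h1, -⟩ | ⟨j', line', r, i, a, t, m, ho, hm, hs⟩
  · rw [← h1] at hl
    simp [Line.idx] at hl
  · cases h1
  · generalize hl' : (⟨j, .hFlip, false⟩ : Local) = l' at hs
    cases hs <;> first
      | (have := congrArg (fun l => l.line.idx) hl'
         simp only [hl] at this
         simp [Line.idx] at this
         done)
      | (cases hl'
         done)
      | skip
    cases hl'
    have := ho.op
    simp only [opAt, Option.some.injEq, Sigma.mk.injEq, heq_eq_eq, true_and, if_pos ‹p.val = 0›] at this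
    subst this
    exact ⟨t, m, ho, hm⟩

theorem exists_flip {T j : ℕ} {c : Fin 2} (h : (σ T).loc p = ⟨j, .hWriteC c, false⟩) :
    ∃ t < T, Occurs σ t (.flip p c) ∧ (σ t).loc p = ⟨j, .hFlip, false⟩ := by
  have hl := idx_loopStart p
  rcases hσ.exists_pred p h with ⟨-, h1⟩ | ⟨c', h1, h2⟩ | ⟨j', line', r, i, a, t, m, ho, hm, hs⟩
  · rw [← h1] at hl
    simp [Line.idx] at hl
  · obtain rfl : c = c' := by simpa using h1
    exact h2
  · generalize hl' : (⟨j, .hWriteC c, false⟩ : Local) = l' at hs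
    cases hs <;> first
      | (have := congrArg (fun l => l.line.idx) hl'
         simp only [hl] at this
         simp [Line.idx] at this
         done)
      | (cases hl')

/-- The last operation of a host in a round after which it continues. -/
theorem exists_host_read {T j : ℕ} (hp : p.val < 2) (hj : 1 ≤ j) (h : j < ((σ T).loc p).round) :
    ∃ v t m, OpDone σ p j .hReadR2 .R2 .read (.value v) t m ∧ m < T ∧ n - 2 ≤ v := by
  obtain ⟨line, r, i, a, t, m, ho, hm, hs⟩ := hσ.exists_round_succ p hj h
  have hl := hσ.line_of p t
  rw [ho.loc_inv] at hl
  generalize hl' : (⟨j + 1, loopStart p, false⟩ : Local) = l' at hs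
  cases hs <;> simp_all [Line.Of]
  · have := ho.op
    simp [opAt] at this
    subst this
    exact ⟨_, t, m, ho, hm, by simpa⟩
  · omega

theorem exists_pWriteR2 {T j : ℕ} (hp : 2 ≤ p.val) (hj : 1 ≤ j) (h : j < ((σ T).loc p).round) :
    ∃ t < T, ∃ v, (σ t).loc p = ⟨j, .pWriteR2 v, false⟩ := by
  obtain ⟨line, r, i, a, t, m, ho, hm, hs⟩ := hσ.exists_round_succ p hj h
  have hl := hσ.line_of p t
  rw [ho.loc_inv] at hl
  have hlt := ho.lt
  refine ⟨t, by omega, ?_⟩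
  rw [ho.loc_inv]
  generalize hl' : (⟨j + 1, loopStart p, false⟩ : Local) = l' at hs
  cases hs <;> simp_all [Line.Of]
  omega

theorem exists_pResetR2 {T j : ℕ} (hp : 2 ≤ p.val) (hj : 1 ≤ j) (h : ((σ T).loc p).Passed j) :
    ∃ t ≤ T, (σ t).loc p = ⟨j, .pResetR2, false⟩ := by
  have h1 : ∃ t ≤ T, ∃ line : Line, (σ t).loc p = ⟨j, line, false⟩ ∧ 5 ≤ line.idx ∧ line.idx ≤ 7 := by
    rcases h with h | ⟨h2, h3⟩
    · obtain ⟨t, ht, v, h4⟩ := hσ.exists_pWriteR2 hp hj h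
      exact ⟨t, ht.le, _, h4, by simp [Line.idx]⟩
    · generalize hl : (σ T).loc p = l at *
      obtain ⟨j', line, w⟩ := l
      obtain rfl : j' = j := h2
      rcases w
      · exact ⟨T, le_rfl, line, hl, h3⟩
      · obtain ⟨t, ht, -, -, -, h4, -⟩ := hσ.exists_inv_of_waiting p hl
        exact ⟨t, ht.le, line, h4, h3⟩
  obtain ⟨t, ht, line, hl, h2⟩ := h1
  have read : ∀ t ≤ T, (σ t).loc p = ⟨j, .pReadR2, false⟩ →
      ∃ t ≤ T, (σ t).loc p = ⟨j, .pResetR2, false⟩ := fun t ht hl => by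
    obtain ⟨s, m, ho, hm⟩ := hσ.exists_opDone_pReadR2 hl
    have := ho.lt
    exact ⟨s, by omega, ho.loc_inv⟩
  cases line <;> simp [Line.idx] at h2
  · exact ⟨t, ht, hl⟩
  · exact read t ht hl
  · obtain ⟨v, s, m, ho, hm, -⟩ := hσ.exists_opDone_pWriteR2 hl
    have := ho.lt
    exact read s (by omega) ho.loc_inv

end IsExecution

/-! ### Rounds of the game -/

/-- The operations of a player from the start of its round `j` to the tests that it passes. -/
structure IsPass (σ : ℕ → State I) (q : Fin n) (j T : ℕ) (c : Fin 2)
    (t₁ m₁ t₂ m₂ t₃ m₃ t₄ m₄ t₅ m₅ : ℕ) : Prop where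
  resetR1 : OpDone σ q j .pResetR1 .R1 (.write none) .ack t₁ m₁
  resetC : OpDone σ q j .pResetC .C (.write none) .ack t₂ m₂
  readFirst : OpDone σ q j .pReadFirst .R1 .read (.value (some (c, j))) t₃ m₃
  readSecond : OpDone σ q j (.pReadSecond (some (c, j))) .R1 .read (.value (some (1 - c, j))) t₄ m₄
  readC : OpDone σ q j (.pReadC (some (c, j)) (some (1 - c, j))) .C .read (.value (some c)) t₅ m₅
  lt₁ : m₁ < t₂
  lt₂ : m₂ < t₃
  lt₃ : m₃ < t₄
  lt₄ : m₄ < t₅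
  lt₅ : m₅ < T

/-- The two values that a player reads in `R1` are written in the order in which it reads them. -/
theorem IsPass.exists_writes_R1 {σ : ℕ → State I} {q : Fin n} {j T : ℕ} {c : Fin 2} {t₁ m₁ t₂ m₂ t₃ m₃ t₄ m₄ t₅ m₅ : ℕ}
    (h : IsPass σ q j T c t₁ m₁ t₂ m₂ t₃ m₃ t₄ m₄ t₅ m₅) {ord : ℕ → ℕ}
    (ho : IsLinearOrder σ .R1 T ord) :
    ∃ s < T, ∃ s' < T, ∃ p p', Occurs σ s (.reg .R1 (.inv p (.write (some (c, j))))) ∧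
      Occurs σ s' (.reg .R1 (.inv p' (.write (some (1 - c, j))))) ∧ ord s ≤ ord s' ∧
      ord s' < ord t₄ := by
  obtain ⟨h₁, h₂, h₃, h₄, h₅, l₁, l₂, l₃, l₄, l₅⟩ := h
  have := h₁.lt
  have := h₂.lt
  have := h₃.lt
  have := h₄.lt
  have := h₅.lt
  obtain ⟨s, hs, p, h6, -, h7⟩ := ho.read h₃ (by omega) h₁.inv (by omega)
    (ho.order h₁ (by omega) h₃.inv (by omega) (by omega))
  obtain ⟨s', hs', p', h8, h9, h10⟩ := ho.read h₄ (by omega) h6 hs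
    (h7.trans (ho.order h₃ (by omega) h₄.inv (by omega) l₃))
  exact ⟨s, hs, s', hs', p, p', h6, h8, h9, h10⟩

namespace IsExecution

variable {σ : ℕ → State I} (hσ : IsExecution σ)

include hσ

theorem exists_isPass {q : Fin n} {j T : ℕ} (hq : 2 ≤ q.val) (hj : 1 ≤ j)
    (h : ((σ T).loc q).Passed j) :
    ∃ c t₁ m₁ t₂ m₂ t₃ m₃ t₄ m₄ t₅ m₅, IsPass σ q j T c t₁ m₁ t₂ m₂ t₃ m₃ t₄ m₄ t₅ m₅ := by
  obtain ⟨t, ht, hl⟩ := hσ.exists_pResetR2 hq hj h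
  obtain ⟨c, t₅, m₅, h₅, hm₅⟩ := hσ.exists_opDone_pResetR2 hl
  obtain ⟨t₄, m₄, h₄, hm₄⟩ := hσ.exists_opDone_pReadC h₅.loc_inv
  obtain ⟨t₃, m₃, h₃, hm₃⟩ := hσ.exists_opDone_pReadSecond h₄.loc_inv
  obtain ⟨t₂, m₂, h₂, hm₂⟩ := hσ.exists_opDone_pReadFirst h₃.loc_inv
  obtain ⟨t₁, m₁, h₁, hm₁⟩ := hσ.exists_opDone_pResetC h₂.loc_inv
  exact ⟨c, t₁, m₁, t₂, m₂, t₃, m₃, t₄, m₄, t₅, m₅, h₁, h₂, h₃, h₄, h₅, hm₁, hm₂, hm₃, hm₄,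
    hm₅.trans_le ht⟩

theorem write_R1_unique {i : Fin 2} {j t t' : ℕ} {p p' : Fin n}
    (h : Occurs σ t (.reg .R1 (.inv p (.write (some (i, j))))))
    (h' : Occurs σ t' (.reg .R1 (.inv p' (.write (some (i, j)))))) : t = t' := by
  obtain ⟨h1, h2⟩ := hσ.write_R1 h
  obtain ⟨h3, h4⟩ := hσ.write_R1 h'
  obtain rfl : p = p' := Fin.ext (h2.trans h4.symm)
  exact hσ.inv_unique p h h' (by rw [h1, h3])

variable {v₀ : ∀ r : Reg, Val r}
  (hlin : ∀ r t, ∃ S, IsLinearization (v₀ r) (hist r (σ t).log) S)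

include hlin

theorem exists_isLinearOrder (r : Reg) (T : ℕ) : ∃ ord, IsLinearOrder σ r T ord := by
  obtain ⟨S, hS⟩ := hlin r T
  exact ⟨_, hσ.isLinearOrder_linPos hS⟩

/-- No player passes the tests of a round before both hosts enter it. -/
theorem le_round_of_passed {q : Fin n} {j T : ℕ} (hq : 2 ≤ q.val) (hj : 1 ≤ j)
    (h : ((σ T).loc q).Passed j) {p : Fin n} (hp : p.val < 2) : j ≤ ((σ T).loc p).round := by
  obtain ⟨c, t₁, m₁, t₂, m₂, t₃, m₃, t₄, m₄, t₅, m₅, hpass⟩ := hσ.exists_isPass hq hj h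
  obtain ⟨ord, ho⟩ := hσ.exists_isLinearOrder hlin .R1 T
  obtain ⟨s, hs, s', hs', p₁, p₂, h1, h2, -⟩ := hpass.exists_writes_R1 ho
  obtain ⟨h3, h4⟩ := hσ.write_R1 h1
  obtain ⟨h5, h6⟩ := hσ.write_R1 h2
  have key : ∀ {s : ℕ} {p' : Fin n} {l : Line}, s < T → (σ s).loc p' = ⟨j, l, false⟩ →
      p = p' → j ≤ ((σ T).loc p).round := by
    rintro s p' l hs h7 rfl
    have := hσ.round_mono p hs.le
    simpa only [h7] using this
  -- The values read name both hosts, so `p` wrote one of them.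
  by_cases hc : p.val = c.val
  · exact key hs h3 (Fin.ext (hc.trans h4.symm))
  · refine key hs' h5 (Fin.ext ?_)
    rw [h6]
    fin_cases c <;> simp at hc ⊢ <;> omega

/-- A positive value that a host or a player of round `j` may find in `R2` was written by a player
in round `j`. -/
theorem isIncrement_of_isLinearOrder {T j v t m w t₁ tx mx : ℕ} {h p₁ x : Fin n} {line : Line}
    {i : Invocation (Val .R2)} {a : Response (Val .R2)} {ord : ℕ → ℕ}
    (ho : IsLinearOrder σ .R2 T ord) (hh : h.val < 2)
    (ih : ∀ j' < j, 1 ≤ j' → ∀ v t m, OpDone σ h j' .hReadR2 .R2 .read (.value v) t m → m < T →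
      n - 2 ≤ v → ∀ q : Fin n, 2 ≤ q.val → ∃ t' < T, ∃ w, IsIncrement σ q j' w t' ∧ ord t' < ord t)
    (hr : OpDone σ h j .hReadR2 .R2 .read (.value v) t m) (hm : m < T) (hw : 1 ≤ w)
    (h₁ : Occurs σ t₁ (.reg .R2 (.inv p₁ (.write w)))) (ht₁ : t₁ < T)
    (hx : OpDone σ x j line .R2 i a tx mx) (hmx : mx < T) (hhx : j ≤ ((σ tx).loc h).round)
    (hle : ord tx ≤ ord t₁) (hlt : ord t₁ < ord t) : IsIncrement σ p₁ j w t₁ ∧ 2 ≤ p₁.val := by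
  obtain ⟨⟨j', hinc⟩, hp₁⟩ := hσ.isIncrement_of_write hw h₁
  refine ⟨?_, hp₁⟩
  have h1 : 1 ≤ j' := by
    have := hσ.one_le_round p₁ t₁
    rwa [hinc.loc] at this
  have h2 : t₁ < m := ho.lt_of_lt hr hm h₁ ht₁ hlt
  -- An increment of a later round would require that the host had already entered that round, but
  -- it is still reading in round `j` at time `m`.
  have h3 : j' ≤ j := by
    have h4 := hσ.le_round_of_passed hlin hp₁ h1 hinc.passed hh
    have h5 := hσ.round_mono h h2.le
    simp only [hr.loc_wait m hr.lt le_rfl] at h5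
    exact h4.trans h5
  rcases h3.eq_or_lt with rfl | hlt'
  · exact hinc
  · exfalso
    have hxlt := hx.lt
    -- In an earlier round `j'`, the increment of `p₁` is linearized before the host's read of round
    -- `j'` by induction. That read is answered before `x` starts, so the increment precedes `tx`,
    -- against `hle`.
    obtain ⟨v', t', m', h4, h5, h6⟩ := hσ.exists_host_read hh h1 (hlt'.trans_le hhx)
    obtain ⟨t'', ht'', w', h7, h8⟩ := ih j' hlt' h1 v' t' m' h4 (by omega) h6 p₁ hp₁
    obtain ⟨rfl, -⟩ := hσ.increment_unique hinc h7
    have h9 := ho.order h4 (by omega) hx.inv (by omega) h5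
    omega

/-- The values below that of an increment in round `j` also come from increments in round `j`. -/
theorem exists_increments_below {T j v t m : ℕ} {h : Fin n} {ord : ℕ → ℕ}
    (ho : IsLinearOrder σ .R2 T ord) (hh : h.val < 2) (hj : 1 ≤ j)
    (ih : ∀ j' < j, 1 ≤ j' → ∀ v t m, OpDone σ h j' .hReadR2 .R2 .read (.value v) t m → m < T →
      n - 2 ≤ v → ∀ q : Fin n, 2 ≤ q.val → ∃ t' < T, ∃ w, IsIncrement σ q j' w t' ∧ ord t' < ord t)
    (hr : OpDone σ h j .hReadR2 .R2 .read (.value v) t m) (hm : m < T) :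
    ∀ (w t₁ : ℕ) (q : Fin n), IsIncrement σ q j w t₁ → 2 ≤ q.val → t₁ < T → ord t₁ < ord t →
      ∀ w', 1 ≤ w' → w' ≤ w → ∃ q' : Fin n, ∃ t', IsIncrement σ q' j w' t' ∧ 2 ≤ q'.val ∧ t' < T ∧
        ord t' < ord t := by
  intro w
  induction w with
  | zero => intro _ _ _ _ _ _ w' h1 h2; omega
  | succ w ihw =>
    intro t₁ q hinc hq ht₁ hlt w' h1 h2
    rcases h2.eq_or_lt with rfl | h2
    · exact ⟨q, t₁, hinc, hq, ht₁, hlt⟩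
    -- The writer of `w + 1` has read `w` after its own reset, so `w` was written since that reset.
    obtain ⟨w₀, tr, mr, h3, h4, h5⟩ := hσ.exists_opDone_pWriteR2 hinc.loc
    obtain rfl : w = w₀ := by omega
    obtain ⟨tx, mx, h6, h7⟩ := hσ.exists_opDone_pReadR2 h3.loc_inv
    have := h3.lt
    have := h6.lt
    have h8 := ho.order h6 (by omega) h3.inv (by omega) h7
    have h9 := ho.order h3 (by omega) hinc.inv ht₁ h4
    obtain ⟨t₂, ht₂, p₂, h10, h11, h12⟩ := ho.read h3 (by omega) h6.inv (by omega) h8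
    -- At its reset of `R2` the player is past its tests, so the host has entered round `j` by then,
    -- as the exclusion of earlier rounds requires.
    have hpass : ((σ tx).loc q).Passed j := by
      rw [h6.loc_inv]
      exact Or.inr ⟨rfl, by simp [Line.idx]⟩
    obtain ⟨h13, h14⟩ := hσ.isIncrement_of_isLinearOrder hlin ho hh ih hr hm (by omega) h10 ht₂ h6
      (by omega) (hσ.le_round_of_passed hlin hq hj hpass hh) h11 (by omega)
    exact ihw t₂ p₂ h13 h14 ht₂ (by omega) w' h1 (by omega)

/-- A host continues after round `j` only if all players have incremented the counter in round `j`
before. -/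
theorem exists_increment_of_host_read (hn : 3 ≤ n) {T : ℕ} {h : Fin n} {ord : ℕ → ℕ}
    (ho : IsLinearOrder σ .R2 T ord) (hh : h.val < 2) (j : ℕ) (hj : 1 ≤ j) (v t m : ℕ)
    (hr : OpDone σ h j .hReadR2 .R2 .read (.value v) t m) (hm : m < T) (hv : n - 2 ≤ v)
    (q : Fin n) (hq : 2 ≤ q.val) :
    ∃ t' < T, ∃ w, IsIncrement σ q j w t' ∧ ord t' < ord t := by
  induction j using Nat.strong_induction_on generalizing v t m q with
  | _ j ih =>
    have ih' : ∀ j' < j, 1 ≤ j' → ∀ v t m, OpDone σ h j' .hReadR2 .R2 .read (.value v) t m →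
        m < T → n - 2 ≤ v → ∀ q : Fin n, 2 ≤ q.val →
        ∃ t' < T, ∃ w, IsIncrement σ q j' w t' ∧ ord t' < ord t :=
      fun j' hj' h1 v t m h2 h3 h4 q h5 => ih j' hj' h1 v t m h2 h3 h4 q h5
    have := hr.lt
    obtain ⟨tx, mx, h1, h2⟩ := hσ.exists_opDone_hReadR2 hr.loc_inv
    have := h1.lt
    have h3 := ho.order h1 (by omega) hr.inv (by omega) h2
    obtain ⟨t₁, ht₁, p₁, h4, h5, h6⟩ := ho.read hr hm h1.inv (by omega) h3
    -- The value read is positive because `n - 2 ≥ 1`; with `x` the host itself, it was written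
    -- since the host's reset.
    obtain ⟨h7, h8⟩ := hσ.isIncrement_of_isLinearOrder hlin ho hh ih' hr hm (by omega) h4 ht₁ h1
      (by omega) (by rw [h1.loc_inv]) h5 h6
    have key := hσ.exists_increments_below hlin ho hh hj ih' hr hm v t₁ p₁ h7 h8 ht₁ h6
    have key' : ∀ k : Fin (n - 2), ∃ q' : Fin n, ∃ t', IsIncrement σ q' j (k.val + 1) t' ∧
        2 ≤ q'.val ∧ t' < T ∧ ord t' < ord t := fun k => key _ (by omega) (by omega)
    choose f g hfg using key'
    -- Pigeonhole: sending the value `k + 1` to its writer is injective, as a player writes one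
    -- counter value per round, hence it reaches all players. The shift by `2` skips the hosts.
    have hinj : Function.Injective fun k : Fin (n - 2) =>
        (⟨(f k).val - 2, by have := (hfg k).2.1; omega⟩ : Fin (n - 2)) := by
      intro k k' hkk
      simp only [Fin.mk.injEq] at hkk
      have hf : f k = f k' := Fin.ext (by have := (hfg k).2.1; have := (hfg k').2.1; omega)
      have h9 := (hfg k).1
      rw [hf] at h9
      have := (hσ.increment_unique h9 (hfg k').1).2
      exact Fin.ext (by omega)
    obtain ⟨k, hk⟩ := (Finite.surjective_of_injective hinj) ⟨q.val - 2, by omega⟩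
    simp only [Fin.mk.injEq] at hk
    obtain ⟨h9, h10, h11, h12⟩ := hfg k
    have hf : f k = q := Fin.ext (by omega)
    exact ⟨g k, h11, _, hf ▸ h9, h12⟩

/-- When a host has left round `j` for the next one, all players have passed the tests of round `j`. -/
theorem exists_increment_of_host (hn : 3 ≤ n) {T j : ℕ} {h : Fin n} (hh : h.val < 2) (hj : 1 ≤ j)
    (hT : j < ((σ T).loc h).round) (q : Fin n) (hq : 2 ≤ q.val) :
    ∃ t < T, ∃ w, IsIncrement σ q j w t := by
  obtain ⟨v, t, m, h1, h2, h3⟩ := hσ.exists_host_read hh hj hT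
  obtain ⟨ord, ho⟩ := hσ.exists_isLinearOrder hlin .R2 T
  obtain ⟨t', ht', w, h4, -⟩ :=
    hσ.exists_increment_of_host_read hlin hn ho hh j hj v t m h1 h2 h3 q hq
  exact ⟨t', ht', w, h4⟩

/-- The value that a player reads in `C` in round `j` is the outcome of the coin flip of round `j`. -/
theorem exists_write_C (hn : 3 ≤ n) {T : ℕ} {q : Fin n} (hq : 2 ≤ q.val) {ord : ℕ → ℕ}
    (ho : IsLinearOrder σ .C T ord) (j : ℕ) (hj : 1 ≤ j) (u₁ u₂ : Option (Fin 2 × ℕ)) (c : Fin 2)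
    (t m : ℕ) (hr : OpDone σ q j (.pReadC u₁ u₂) .C .read (.value (some c)) t m) (hm : m < T) :
    ∃ t' < T, ∃ p, Occurs σ t' (.reg .C (.inv p (.write (some c)))) ∧
      (σ t').loc p = ⟨j, .hWriteC c, false⟩ ∧ ord t' < ord t := by
  induction j using Nat.strong_induction_on generalizing u₁ u₂ c t m with
  | _ j ih =>
    have := hr.lt
    obtain ⟨t₄, m₄, h₄, hm₄⟩ := hσ.exists_opDone_pReadC hr.loc_inv
    obtain ⟨t₃, m₃, h₃, hm₃⟩ := hσ.exists_opDone_pReadSecond h₄.loc_inv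
    obtain ⟨t₂, m₂, h₂, hm₂⟩ := hσ.exists_opDone_pReadFirst h₃.loc_inv
    have := h₂.lt
    have := h₃.lt
    have := h₄.lt
    obtain ⟨t', ht', p, h5, h6, h7⟩ := ho.read hr hm h₂.inv (by omega)
      (ho.order h₂ (by omega) hr.inv (by omega) (by omega))
    obtain ⟨⟨j', h8⟩, hp⟩ := hσ.write_C h5
    have hlt : t' < m := ho.lt_of_lt hr hm h5 ht' h7
    rcases lt_trichotomy j' j with hjj | rfl | hjj
    · exfalso
      have hj' : 1 ≤ j' := by
        have := hσ.one_le_round p t'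
        rwa [h8] at this
      have hpass : ((σ t₂).loc q).Passed j' := by
        rw [h₂.loc_inv]
        exact Or.inl hjj
      -- A coin of an earlier round `j'`: by induction its only write is linearized before the read
      -- of `C` by `q` in round `j'`, hence before the reset of `C` in round `j`.
      obtain ⟨c', s₁, n₁, s₂, n₂, s₃, n₃, s₄, n₄, s₅, n₅, h9⟩ := hσ.exists_isPass hq hj' hpass
      have hlt₅ := h9.lt₅
      have hlt₅' := h9.readC.lt
      obtain ⟨t'', ht'', p', h10, h11, h12⟩ :=
        ih j' hjj hj' _ _ c' s₅ n₅ h9.readC (by omega)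
      obtain ⟨-, hp'⟩ := hσ.write_C h10
      obtain rfl : p = p' := Fin.ext (hp.trans hp'.symm)
      obtain rfl := hσ.inv_unique p h5 h10 (by rw [h8, h11]; rfl)
      have h13 := ho.order h9.readC (by omega) h₂.inv (by omega) hlt₅
      omega
    · exact ⟨t', ht', p, h5, h8, h7⟩
    · exfalso
      -- A coin of a later round: host `0` would have left round `j`, so `q` would have invoked its
      -- counter write of round `j` before `m`, when it is still reading `C`.
      obtain ⟨s, hs, w, h9⟩ := hσ.exists_increment_of_host hlin hn (T := t') (j := j) (h := p)
        (by omega) hj (by rw [h8]; exact hjj) q hq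
      have h10 := hσ.rank_mono q (hs.trans hlt).le
      simp only [h9.loc, hr.loc_wait m hr.lt le_rfl] at h10
      simp [Local.rank, Line.idx] at h10

end IsExecution

/-! ### The coin and the order of the hosts' writes -/

open Classical in
/-- The index of the host whose value of round `j` is written first in `S`. -/
noncomputable def firstWritten (S : List (SeqOp (Fin n) (Val .R1))) (j : ℕ) : Fin 2 :=
  if WrittenBefore S (some (1, j)) (some (0, j)) then 1 else 0

namespace IsExecution

variable {σ : ℕ → State I} (hσ : IsExecution σ) {v₀ : ∀ r : Reg, Val r}
  (hlin : ∀ r t, ∃ S, IsLinearization (v₀ r) (hist r (σ t).log) S)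
  {f : List (Event (Fin n) (Val .R1) (I .R1).Act) → List (SeqOp (Fin n) (Val .R1))}
  (hf : IsWriteStrongLinearizationFunction (v₀ .R1) (I .R1).histories f)

include hσ hlin hf

/-- If a player passes the tests of round `j`, then the coin of round `j` shows the index of the host
whose write was linearized first, and this is determined before the flip. -/
theorem exists_flip_of_passed (hn : 3 ≤ n) {T j : ℕ} {q : Fin n} (hq : 2 ≤ q.val) (hj : 1 ≤ j)
    (h : ((σ T).loc q).Passed j) :
    ∃ s < T, ∃ p, ((σ s).loc p).round = j ∧
      Occurs σ s (.flip p (firstWritten (f (hist .R1 (σ s).log)) j)) := by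
  obtain ⟨c, t₁, m₁, t₂, m₂, t₃, m₃, t₄, m₄, t₅, m₅, hpass⟩ := hσ.exists_isPass hq hj h
  obtain ⟨ordC, hoC⟩ := hσ.exists_isLinearOrder hlin .C T
  obtain ⟨t', ht', p, h1, h2, -⟩ :=
    hσ.exists_write_C hlin hn hq hoC j hj _ _ c t₅ m₅ hpass.readC hpass.lt₅
  obtain ⟨s, hs, h3, h4⟩ := hσ.exists_flip h2
  refine ⟨s, hs.trans ht', p, by rw [h4], ?_⟩
  suffices hc : firstWritten (f (hist .R1 (σ s).log)) j = c by rwa [hc]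
  obtain ⟨t₀, m₀, h5, h6⟩ := hσ.exists_opDone_hFlip h4
  have hS := hf.1 _ (hσ.hist_mem_histories .R1 s)
  have hS' := hf.1 _ (hσ.hist_mem_histories .R1 T)
  have hpre := hf.2 _ (hσ.hist_mem_histories .R1 s) _ (hσ.hist_mem_histories .R1 T)
    (hσ.hist_prefix .R1 (hs.trans ht').le)
  have once : ∀ i : Fin 2, WrittenOnce (f (hist .R1 (σ T).log)) (some (i, j)) := fun i =>
    hσ.writtenOnce hS' hσ.write_R1_unique
  have hnd : (f (hist .R1 (σ T).log)).Nodup := hS'.once.of_map _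
  obtain ⟨a, ha, a', ha', p₁, p₂, h7, h8, h9, h10⟩ :=
    hpass.exists_writes_R1 (hσ.isLinearOrder_linPos hS')
  have hlt₄ := hpass.readSecond.lt
  have hlt₄' := hpass.lt₄
  have hlt₅ := hpass.readC.lt
  have hlt₅' := hpass.lt₅
  have hbefore : WrittenBefore (f (hist .R1 (σ T).log)) (some (c, j)) (some (1 - c, j)) := by
    refine hσ.writtenBefore hS' h7 ha h8 ha' ?_ h9 ?_
    · rintro rfl
      have := h7.unique h8
      fin_cases c <;> simp at this
    · obtain ⟨o, ho, -⟩ := hσ.exists_linearized hS' hpass.readSecond (by omega)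
      exact h10.trans (List.getElem?_eq_some_iff.mp ho).1
  -- Host `0` flips only after its write is answered, so `[0, j]` is linearized at time `s`. The
  -- value `[1, j]` may be absent then, which `firstWritten` counts as coming later.
  have hzero : ∃ o ∈ f (hist .R1 (σ s).log), o.inv = .write (some (0, j)) := by
    obtain ⟨o, ho, hi, -⟩ := hσ.exists_linearized hS h5 h6
    exact ⟨o, List.mem_of_getElem? ho, hi⟩
  have hc : c = 0 ∨ c = 1 := by fin_cases c <;> simp
  unfold firstWritten
  rcases hc with rfl | rfl
  -- If `[1, j]` were before `[0, j]` at the flip, it would remain so.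
  · rw [if_neg]
    intro h11
    exact (h11.mono hpre).asymm hnd (once 1) (once 0) hbefore
  -- What finally precedes `[0, j]` precedes it already at the flip.
  · rw [if_pos]
    exact hbefore.of_prefix hpre hnd (once 0) hzero

/-- If some process enters round `j + 1`, then the coin of round `j` shows the index of the host
whose write was linearized first before the flip. -/
theorem exists_flip_of_round (hn : 3 ≤ n) {T j : ℕ} {p : Fin n} (hj : 1 ≤ j)
    (h : j < ((σ T).loc p).round) :
    ∃ s p, ((σ s).loc p).round = j ∧
      Occurs σ s (.flip p (firstWritten (f (hist .R1 (σ s).log)) j)) := by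
  have key : ∃ T, ∃ q : Fin n, 2 ≤ q.val ∧ ((σ T).loc q).Passed j := by
    by_cases hp : 2 ≤ p.val
    · exact ⟨T, p, hp, Or.inl h⟩
    -- A host that goes on has seen increments by all players; process `2` is one because `n ≥ 3`.
    · obtain ⟨t, -, w, h1⟩ := hσ.exists_increment_of_host hlin hn (by omega) hj h ⟨2, hn⟩ le_rfl
      exact ⟨t, ⟨2, hn⟩, le_rfl, h1.passed⟩
  obtain ⟨T, q, hq, h1⟩ := key
  obtain ⟨s, -, p, h2⟩ := hσ.exists_flip_of_passed hlin hf hn hq hj h1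
  exact ⟨s, p, h2⟩

end IsExecution

/-! ### Coin flips -/

section Coins

open MeasureTheory ProbabilityTheory

instance : IsProbabilityMeasure coinMeasure := by
  unfold coinMeasure
  infer_instance

/-- A set of coin sequences that is determined by the coins before time `t`. -/
def DeterminedBefore (t : ℕ) (A : Set (ℕ → Fin 2)) : Prop :=
  ∀ ω ω' : ℕ → Fin 2, (∀ i < t, ω i = ω' i) → (ω ∈ A ↔ ω' ∈ A)

theorem DeterminedBefore.exists_preimage {t : ℕ} {A : Set (ℕ → Fin 2)} (h : DeterminedBefore t A) :
    ∃ B : Set (Finset.range t → Fin 2), A = (fun ω (i : Finset.range t) => ω i) ⁻¹' B := by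
  -- The coordinates from `t` on are filled with `0`; they do not affect membership in `A`.
  refine ⟨{x | (fun i => if hi : i ∈ Finset.range t then x ⟨i, hi⟩ else 0) ∈ A}, ?_⟩
  ext ω
  refine h _ _ fun i hi => ?_
  simp [hi]

theorem DeterminedBefore.measurableSet {t : ℕ} {A : Set (ℕ → Fin 2)} (h : DeterminedBefore t A) :
    MeasurableSet A := by
  obtain ⟨B, rfl⟩ := h.exists_preimage
  exact (by fun_prop : Measurable fun (ω : ℕ → Fin 2) (i : Finset.range t) => ω i)
    (Set.toFinite B).measurableSet

theorem coinMeasure_eval (t : ℕ) (c : Fin 2) : coinMeasure {ω | ω t = c} = 1 / 2 := by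
  have h := (measurePreserving_eval_infinitePi
    (fun _ : ℕ => (PMF.uniformOfFintype (Fin 2)).toMeasure) t).measure_preimage
      (measurableSet_singleton c).nullMeasurableSet
  rw [PMF.toMeasure_apply_singleton _ _ (measurableSet_singleton c)] at h
  rw [PMF.uniformOfFintype_apply, Fintype.card_fin, Nat.cast_ofNat] at h
  rw [one_div]
  exact h

/-- The coin at time `t` is independent of the coins before. -/
theorem DeterminedBefore.measure_inter {t : ℕ} {A : Set (ℕ → Fin 2)} (h : DeterminedBefore t A)
    (c : Fin 2) : coinMeasure (A ∩ {ω | ω t = c}) = coinMeasure A * (1 / 2) := by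
  obtain ⟨B, rfl⟩ := h.exists_preimage
  have hind : iIndepFun (fun (i : ℕ) (ω : ℕ → Fin 2) => ω i) coinMeasure :=
    iIndepFun_infinitePi (X := fun _ x => x) (fun _ => measurable_id)
  have h2 := (hind.indepFun_finset (Finset.range t) {t} (by simp) (by fun_prop)).measure_inter_preimage_eq_mul
    B {x | x ⟨t, Finset.mem_singleton_self t⟩ = c} (Set.toFinite _).measurableSet
      (Set.toFinite _).measurableSet
  rw [← coinMeasure_eval t c]
  exact h2

/-- The prediction is fixed before time `t`; on each of the two sets where it is constant, the coin
is independent of the past. -/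
theorem measure_guess {t : ℕ} {A : Set (ℕ → Fin 2)} (hA : DeterminedBefore t A)
    {b : (ℕ → Fin 2) → Fin 2} (hb : ∀ c, DeterminedBefore t {ω | b ω = c}) :
    coinMeasure (A ∩ {ω | ω t = b ω}) ≤ coinMeasure A * (1 / 2) := by
  have hd : ∀ c, DeterminedBefore t (A ∩ {ω | b ω = c}) := fun c ω ω' h =>
    and_congr (hA ω ω' h) (hb c ω ω' h)
  have h1 : A ∩ {ω | ω t = b ω} ⊆ ((A ∩ {ω | b ω = 0}) ∩ {ω | ω t = 0}) ∪
      ((A ∩ {ω | b ω = 1}) ∩ {ω | ω t = 1}) := by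
    rintro ω ⟨h1, h2⟩
    have : b ω = 0 ∨ b ω = 1 := by generalize b ω = c; fin_cases c <;> simp
    rcases this with h3 | h3
    · exact Or.inl ⟨⟨h1, h3⟩, h2.trans h3⟩
    · exact Or.inr ⟨⟨h1, h3⟩, h2.trans h3⟩
  refine (measure_mono h1).trans ((measure_union_le _ _).trans ?_)
  rw [(hd 0).measure_inter, (hd 1).measure_inter, ← add_mul]
  gcongr
  rw [← measure_union _ (hd 1).measurableSet]
  · exact measure_mono (Set.union_subset Set.inter_subset_left Set.inter_subset_left)
  · rw [Set.disjoint_left]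
    rintro ω ⟨-, h2⟩ ⟨-, h3⟩
    simp only [Set.mem_ofPred_eq] at h2 h3
    rw [h2] at h3
    exact absurd h3 (by decide)

/-- A coin that is flipped at a random time shows the value predicted at that time with probability
at most one half. -/
theorem measure_iUnion_guess {A : ℕ → Set (ℕ → Fin 2)} (hA : ∀ t, DeterminedBefore t (A t))
    (hd : Pairwise (Function.onFun Disjoint A)) {b : ℕ → (ℕ → Fin 2) → Fin 2}
    (hb : ∀ t c, DeterminedBefore t {ω | b t ω = c}) :
    coinMeasure (⋃ t, A t ∩ {ω | ω t = b t ω}) ≤ coinMeasure (⋃ t, A t) * (1 / 2) := by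
  rw [measure_iUnion hd fun t => (hA t).measurableSet, ← ENNReal.tsum_mul_right]
  exact (measure_iUnion_le _).trans (ENNReal.tsum_le_tsum fun t => measure_guess (hA t) (hb t))

end Coins

/-! ### Probability of further rounds -/

theorem run_congr (𝒮 : Adversary I) {ω ω' : ℕ → Fin 2} {t : ℕ} (h : ∀ i < t, ω i = ω' i) :
    run 𝒮 ω t = run 𝒮 ω' t := by
  induction t with
  | zero => rfl
  | succ t ih =>
    rw [run, run, ih fun i hi => h i (by omega), h t (by omega)]

/-- The adversary schedules the coin flip of round `j` at time `t`. -/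
def FlipScheduled (𝒮 : Adversary I) (j t : ℕ) (ω : ℕ → Fin 2) : Prop :=
  ∃ p, 𝒮 (run 𝒮 ω t).log = .flip p ∧ ((run 𝒮 ω t).loc p).line = .hFlip ∧
    ((run 𝒮 ω t).loc p).round = j

theorem FlipScheduled.occurs {𝒮 : Adversary I} {j t : ℕ} {ω : ℕ → Fin 2}
    (h : FlipScheduled 𝒮 j t ω) :
    ∃ p, Occurs (run 𝒮 ω) t (.flip p (ω t)) ∧ ((run 𝒮 ω t).loc p).round = j ∧ p.val = 0 := by
  obtain ⟨p, h1, h2, h3⟩ := h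
  have h4 := (isExecution_run 𝒮 ω).line_of p t
  rw [h2] at h4
  refine ⟨p, ?_, h3, h4⟩
  refine ⟨_, _, if_pos h2, rfl, ?_⟩
  rw [run, h1]
  simp [Choice.toEvent, State.apply, nextLoc, nextConf, h2]

/-- Only process `0` flips coins, and its round never decreases. -/
theorem FlipScheduled.lt {𝒮 : Adversary I} {i j s t : ℕ} {ω : ℕ → Fin 2}
    (h : FlipScheduled 𝒮 i s ω) (h' : FlipScheduled 𝒮 j t ω) (hij : i < j) : s < t := by
  obtain ⟨p, -, h1, h2⟩ := h.occurs
  obtain ⟨q, -, h3, h4⟩ := h'.occurs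
  obtain rfl : p = q := Fin.ext (h2.trans h4.symm)
  by_contra! hle
  have := (isExecution_run 𝒮 ω).round_mono p hle
  simp only at this
  omega

/-- A flip moves process `0` past the location `hFlip` of its round, to which the growing rank
forbids a return. -/
theorem FlipScheduled.unique {𝒮 : Adversary I} {j s t : ℕ} {ω : ℕ → Fin 2}
    (h : FlipScheduled 𝒮 j s ω) (h' : FlipScheduled 𝒮 j t ω) : s = t := by
  have key : ∀ {s t}, FlipScheduled 𝒮 j s ω → FlipScheduled 𝒮 j t ω → t ≤ s := by
    intro s t h h'
    by_contra! hlt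
    obtain ⟨p, h0, h1, h2⟩ := h.occurs
    obtain ⟨q, h0', h3, h4⟩ := h'.occurs
    obtain rfl : p = q := Fin.ext (h2.trans h4.symm)
    have hσ := isExecution_run 𝒮 ω
    have h5 := hσ.rank_mono p (Nat.succ_le_of_lt hlt)
    have h6 := h0.local_step_flip.2
    have h7 := h0'.local_step_flip.1
    have hw : ((run 𝒮 ω t).loc p).waiting = false := by
      by_contra hw
      rw [Bool.not_eq_false] at hw
      obtain ⟨s, -, r', i', -, -, h8, -⟩ := hσ.exists_inv_of_waiting p
        (T := t) (j := ((run 𝒮 ω t).loc p).round) (line := .hFlip) (by rw [← h7, ← hw])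
      simp [opAt] at h8
    simp only [Nat.succ_eq_add_one, h6] at h5
    simp [Local.rank, Line.idx, h7, hw, h1, h3] at h5
    omega
  exact le_antisymm (key h' h) (key h h')

/-- At time `t`, the coin of round `j` is flipped and shows the index of the host whose write was
linearized first. -/
def BadFlip (𝒮 : Adversary I)
    (f : List (Event (Fin n) (Val .R1) (I .R1).Act) → List (SeqOp (Fin n) (Val .R1)))
    (j t : ℕ) (ω : ℕ → Fin 2) : Prop :=
  FlipScheduled 𝒮 j t ω ∧ ω t = firstWritten (f (hist .R1 (run 𝒮 ω t).log)) j

section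

variable (𝒮 : Adversary I)
  (f : List (Event (Fin n) (Val .R1) (I .R1).Act) → List (SeqOp (Fin n) (Val .R1)))

/-- All coins of the rounds up to `J` are bad. -/
def badFlips (J : ℕ) : Set (ℕ → Fin 2) := {ω | ∀ i, 1 ≤ i → i ≤ J → ∃ t, BadFlip 𝒮 f i t ω}

/-- The coin of round `J` is scheduled at time `t`, after bad flips in the previous rounds. -/
def scheduledAfterBad (J t : ℕ) : Set (ℕ → Fin 2) :=
  {ω | FlipScheduled 𝒮 J t ω ∧ ∀ i, 1 ≤ i → i < J → ∃ s < t, BadFlip 𝒮 f i s ω}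

/-- That a flip is scheduled at time `t` does not involve its outcome, so the coins before `t`
decide it; whether the flip is bad depends also on the coin `t`. -/
theorem flipScheduled_congr {ω ω' : ℕ → Fin 2} {j t : ℕ} (h : ∀ i < t, ω i = ω' i) :
    FlipScheduled 𝒮 j t ω ↔ FlipScheduled 𝒮 j t ω' := by
  rw [FlipScheduled, FlipScheduled, run_congr 𝒮 h]

theorem badFlip_congr {ω ω' : ℕ → Fin 2} {j t : ℕ} (h : ∀ i < t + 1, ω i = ω' i) :
    BadFlip 𝒮 f j t ω ↔ BadFlip 𝒮 f j t ω' := by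
  have h' : ∀ i < t, ω i = ω' i := fun i hi => h i (by omega)
  rw [BadFlip, BadFlip, flipScheduled_congr 𝒮 h', run_congr 𝒮 h', h t (by omega)]

theorem determinedBefore_scheduledAfterBad (J t : ℕ) :
    DeterminedBefore t (scheduledAfterBad 𝒮 f J t) := by
  intro ω ω' h
  refine and_congr (flipScheduled_congr 𝒮 h) (forall_congr' fun i => imp_congr_right fun _ =>
    imp_congr_right fun _ => exists_congr fun s => and_congr_right fun hs =>
      badFlip_congr 𝒮 f fun k hk => h k (by omega))

/-- Partition by the time of the flip of round `J + 1`. Bad flips in the earlier rounds happen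
before that time, so conditioning on them does not bias the coin. -/
theorem measure_badFlips (J : ℕ) : coinMeasure (badFlips 𝒮 f J) ≤ (1 / 2) ^ J := by
  induction J with
  | zero => simpa using MeasureTheory.prob_le_one
  | succ J ih =>
    rw [pow_succ]
    have h1 : badFlips 𝒮 f (J + 1) ⊆ ⋃ t, scheduledAfterBad 𝒮 f (J + 1) t ∩
        {ω | ω t = firstWritten (f (hist .R1 (run 𝒮 ω t).log)) (J + 1)} := by
      intro ω hω
      obtain ⟨t, ht⟩ := hω (J + 1) (by omega) le_rfl
      refine Set.mem_iUnion.mpr ⟨t, ⟨ht.1, fun i hi hiJ => ?_⟩, ht.2⟩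
      obtain ⟨s, hs⟩ := hω i hi hiJ.le
      exact ⟨s, hs.1.lt ht.1 hiJ, hs⟩
    have h2 : ⋃ t, scheduledAfterBad 𝒮 f (J + 1) t ⊆ badFlips 𝒮 f J := by
      refine Set.iUnion_subset fun t ω hω i hi hiJ => ?_
      obtain ⟨s, -, hs⟩ := hω.2 i hi (by omega)
      exact ⟨s, hs⟩
    refine (MeasureTheory.measure_mono h1).trans ((measure_iUnion_guess
      (determinedBefore_scheduledAfterBad 𝒮 f (J + 1)) ?_ ?_).trans ?_)
    · intro s t hst
      rw [Function.onFun, Set.disjoint_left]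
      exact fun ω h h' => hst (h.1.unique h'.1)
    · intro t c ω ω' h
      simp only [Set.mem_ofPred_eq]
      rw [run_congr 𝒮 h]
    · gcongr
      exact (MeasureTheory.measure_mono h2).trans ih

end

/-- A process that enters round `j + 1` has seen bad flips in all the rounds up to `j`. -/
theorem mem_badFlips_of_round (hn : 3 ≤ n) {v₀ : ∀ r, Val r}
    (hwsl : ∀ r, (I r).WriteStronglyLinearizable (v₀ r)) (𝒮 : Adversary I)
    {f : List (Event (Fin n) (Val .R1) (I .R1).Act) → List (SeqOp (Fin n) (Val .R1))}
    (hf : IsWriteStrongLinearizationFunction (v₀ .R1) (I .R1).histories f) {ω : ℕ → Fin 2}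
    {T j : ℕ} {p : Fin n} (h : j < ((run 𝒮 ω T).loc p).round) : ω ∈ badFlips 𝒮 f j := by
  intro i hi hij
  have hσ := isExecution_run 𝒮 ω
  have hlin : ∀ r t, ∃ S, IsLinearization (v₀ r) (hist r (run 𝒮 ω t).log) S := fun r t => by
    obtain ⟨g, hg⟩ := hwsl r
    exact ⟨_, hg.1 _ (hσ.hist_mem_histories r t)⟩
  obtain ⟨s, q, h1, h2⟩ := hσ.exists_flip_of_round hlin hf hn hi (hij.trans_lt h)
  -- The event is what the adversary chose, so the choice was this flip and the outcome is the coin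
  -- `ω s`.
  have h3 := occurs_run h2
  refine ⟨s, ⟨q, ?_, h2.local_step_flip.1, h1⟩, ?_⟩ <;>
  · rcases hc : 𝒮 (run 𝒮 ω s).log with _ | _ | _ <;> rw [hc] at h3 <;>
      simp only [Choice.toEvent, GameEvent.flip.injEq, reduceCtorEq] at h3
    simp [h3]

/-! ### Termination -/

namespace IsExecution

variable {σ : ℕ → State I} (hσ : IsExecution σ)

include hσ

/-- The count of events starts at `0` and grows by at most one per step, so it skips no value. -/
theorem exists_regPos_eq {r : Reg} {k T : ℕ} (h : k ≤ regPos σ r T) : ∃ t, regPos σ r t = k := by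
  induction T with
  | zero =>
    have h0 : regPos σ r 0 = 0 := by rw [regPos, hσ.init]; rfl
    exact ⟨0, by omega⟩
  | succ T ih =>
    rcases h.eq_or_lt with rfl | h
    · exact ⟨T + 1, rfl⟩
    · refine ih ?_
      rcases hσ.hist_succ r T with h1 | ⟨e, -, h1⟩
      · rw [regPos, h1] at h; exact h.le
      · rw [regPos, h1, List.length_append] at h
        exact Nat.le_of_lt_succ h

/-- If a register has infinitely many events, they form an infinite history. -/
theorem exists_infinite_history {r : Reg} (h : ∀ k, ∃ t, k ≤ regPos σ r t) :
    ∃ e : ℕ → Event (Fin n) (Val r) (I r).Act, (∀ k, (List.range k).map e ∈ (I r).histories) ∧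
      ∀ t x, Occurs σ t (.reg r x) → e (regPos σ r t) = x := by
  have h1 : ∀ k, ∃ x, ∃ t, Occurs σ t (.reg r x) ∧ regPos σ r t = k := fun k => by
    obtain ⟨T, hT⟩ := h (k + 1)
    have hk : k < (hist r (σ T).log).length := hT
    obtain ⟨t, -, ht⟩ := hσ.exists_occurs (List.getElem?_eq_getElem hk)
    exact ⟨_, t, ht⟩
  choose e g hg using h1
  have h2 : ∀ t x, Occurs σ t (.reg r x) → e (regPos σ r t) = x := fun t x hx => by
    have h3 := hσ.regPos_inj (hg (regPos σ r t)).1 hx (hg _).2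
    have h4 := (hg (regPos σ r t)).1
    rw [h3] at h4
    simpa using h4.unique hx
  refine ⟨e, fun k => ?_, h2⟩
  obtain ⟨T, hT⟩ := h k
  obtain ⟨t, rfl⟩ := hσ.exists_regPos_eq hT
  convert hσ.hist_mem_histories r t using 1
  refine List.ext_getElem (by simp [regPos]) fun k hk hk' => ?_
  obtain ⟨s, -, hs, hsk⟩ := hσ.exists_occurs (List.getElem?_eq_getElem hk')
  simp only [List.getElem_map, List.getElem_range]
  rw [← h2 s _ hs, hsk]

theorem loc_eventually_const {p : Fin n} {J : ℕ} (hJ : ∀ t, ((σ t).loc p).round ≤ J) :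
    ∃ N, ∀ t ≥ N, (σ t).loc p = (σ N).loc p := by
  have hbdd : BddAbove (Set.range fun t => ((σ t).loc p).rank) := by
    -- Here `17 = 2 * 8 + 1`, from the largest index and the flag `waiting`.
    refine ⟨32 * J + 17, ?_⟩
    rintro _ ⟨t, rfl⟩
    have h1 : ∀ l : Line, l.idx ≤ 8 := fun l => by cases l <;> simp [Line.idx]
    have h2 := h1 ((σ t).loc p).line
    have h3 := Bool.toNat_le ((σ t).loc p).waiting
    have h4 := hJ t
    simp only [Local.rank]
    omega
  obtain ⟨N, hN⟩ := Nat.sSup_mem (Set.range_nonempty _) hbdd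
  refine ⟨N, fun t ht => hσ.loc_eq_of_rank_eq p ht ?_⟩
  simp only at hN
  rw [hN]
  exact le_csSup hbdd ⟨t, rfl⟩

/-- A process that takes infinitely many steps in boundedly many rounds returns. -/
theorem exists_returned (hwf : ∀ r, (I r).WaitFree) {p : Fin n} {J : ℕ}
    (hJ : ∀ t, ((σ t).loc p).round ≤ J)
    (hp : {t | ∃ e : GameEvent I, e.IsStepOf p ∧
      (σ (t + 1)).log = (σ t).log ++ [e]}.Infinite) :
    ∃ t, ((σ t).loc p).line = .returned := by
  by_contra! hret
  obtain ⟨N, hN⟩ := hσ.loc_eventually_const hJ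
  -- After time `N` the state of `p` is frozen. Invocations, responses and flips would change it and
  -- an idle step needs a return, so only internal steps of a pending operation remain.
  have hstep : ∀ M, ∃ t ≥ M, ∃ r a, Occurs σ t (.reg r (.step p a)) ∧
      ((σ N).loc p).waiting = true ∧ (opAt p ((σ N).loc p)).map Sigma.fst = some r := by
    intro M
    obtain ⟨t, ⟨e, he, hlog⟩, ht⟩ := hp.exists_gt (max M N)
    have htM : M ≤ t := by omega
    have htN : N ≤ t := by omega
    have hocc : Occurs σ t e := by
      rcases hσ.step t with h | ⟨e', he'⟩
      · rw [h] at hlog; simp at hlog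
      · have := he'.log_succ.symm.trans hlog
        obtain rfl : e' = e := by simpa using this
        exact he'
    have h1 := hN t htN
    have h2 := hN (t + 1) (by omega)
    refine ⟨t, htM, ?_⟩
    rcases e with ⟨r, e⟩ | ⟨q, c⟩ | q
    · rcases e with ⟨q, i⟩ | ⟨q, a⟩ | ⟨q, a⟩ | a
      · obtain rfl : q = p := he
        obtain ⟨h3, -, h4⟩ := hocc.local_step_inv
        rw [h2, h1] at h4
        rw [h1, h4] at h3
        simp at h3
      · obtain rfl : q = p := he
        obtain ⟨h3, h4⟩ := hocc.local_step_res
        obtain ⟨-, -, -, h5⟩ := (responseStep_of_afterResponse h4).opAt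
        rw [h2, ← h1, h3] at h5
        simp at h5
      · obtain rfl : q = p := he
        refine ⟨r, a, hocc, ?_⟩
        obtain ⟨loc, conf, h3, -, -⟩ := hocc
        simp only [nextLoc, Option.ite_none_right_eq_some, h1] at h3
        exact h3.1
      · exact he.elim
    · obtain rfl : q = p := he
      obtain ⟨h3, h4⟩ := hocc.local_step_flip
      rw [h2, ← h1] at h4
      rw [h4] at h3
      simp at h3
    · obtain rfl : q = p := he
      obtain ⟨loc, conf, h3, -, -⟩ := hocc
      simp only [nextLoc, Option.ite_none_right_eq_some] at h3
      exact absurd h3.1 (hret t)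
  obtain ⟨-, -, r, -, -, hw, hr⟩ := hstep 0
  have hsteps : ∀ M, ∃ t ≥ M, ∃ a, Occurs σ t (.reg r (.step p a)) := fun M => by
    obtain ⟨t, ht, r', a, h1, -, h2⟩ := hstep M
    obtain rfl : r = r' := Option.some.inj (hr.symm.trans h2)
    exact ⟨t, ht, a, h1⟩
  have hunb : ∀ k, ∃ t, k ≤ regPos σ r t := fun k => by
    induction k with
    | zero => exact ⟨0, Nat.zero_le _⟩
    | succ k ih =>
      obtain ⟨t, ht⟩ := ih
      obtain ⟨s, hs, a, h1⟩ := hsteps t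
      have h2 := hσ.regPos_mono r hs
      have h3 := hσ.regPos_lt h1 (Nat.lt_add_one s)
      exact ⟨s + 1, by omega⟩
  obtain ⟨e, he, heq⟩ := hσ.exists_infinite_history hunb
  obtain ⟨t, ht, r', i, h1, -, h2, h3⟩ := hσ.exists_inv_of_waiting p
    (T := N) (j := ((σ N).loc p).round) (line := ((σ N).loc p).line) (by rw [← hw])
  obtain rfl : r' = r := by
    have h4 : opAt p ((σ N).loc p) = some ⟨r', i⟩ := h2
    rw [h4] at hr
    simpa using hr
  have hwait : ∀ s, t < s → ((σ s).loc p).waiting = true := fun s hs => by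
    rcases le_total s N with h | h
    · rw [h3 s hs h]
    · rw [hN s h, hw]
  obtain ⟨m, hm, a, h4⟩ := hwf r' e he p (regPos σ r' t) i (heq t _ h1) (by
    refine Set.infinite_of_forall_exists_gt fun k => ?_
    obtain ⟨s, hs⟩ := hunb (k + 1)
    obtain ⟨s', hs', a, h5⟩ := hsteps s
    have h6 := hσ.regPos_mono r' hs'
    exact ⟨regPos σ r' s', ⟨a, heq s' _ h5⟩, by omega⟩)
  obtain ⟨T, hT⟩ := hunb (m + 1)
  have hm' : m < (hist r' (σ T).log).length := hT
  obtain ⟨s, -, hs, rfl⟩ := hσ.exists_occurs (List.getElem?_eq_getElem hm')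
  rw [heq s _ hs] at h4
  rw [h4] at hs
  obtain ⟨-, h5⟩ := hs.local_step_res
  obtain ⟨-, -, -, h6⟩ := (responseStep_of_afterResponse h5).opAt
  rw [hwait (s + 1) ((hσ.lt_of_regPos_lt hm).trans (Nat.lt_succ_self s))] at h6
  simp at h6

end IsExecution

theorem ae_exists_notMem_badFlips (𝒮 : Adversary I)
    (f : List (Event (Fin n) (Val .R1) (I .R1).Act) → List (SeqOp (Fin n) (Val .R1))) :
    ∀ᵐ ω ∂coinMeasure, ∃ J, ω ∉ badFlips 𝒮 f J := by
  rw [MeasureTheory.ae_iff]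
  have hlim : Filter.Tendsto (fun J : ℕ => ((1 : ENNReal) / 2) ^ J) Filter.atTop (nhds 0) :=
    ENNReal.tendsto_pow_atTop_nhds_zero_of_lt_one (by simp)
  refine le_antisymm (ge_of_tendsto' hlim fun J => ?_) zero_le
  refine (MeasureTheory.measure_mono fun ω hω => ?_).trans (measure_badFlips 𝒮 f J)
  by_contra h
  exact hω ⟨J, h⟩

end HostPlayer

theorem mainTheorem2 (n : ℕ) (hn : 3 ≤ n)
    (I : ∀ r : HostPlayer.Reg, HostPlayer.RegisterImpl (Fin n) (HostPlayer.Val r))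
    (v₀ : ∀ r : HostPlayer.Reg, HostPlayer.Val r)
    (hwf : ∀ r, (I r).WaitFree)
    (hwsl : ∀ r, (I r).WriteStronglyLinearizable (v₀ r))
    (𝒮 : HostPlayer.Adversary I) :
    (∀ᵐ ω ∂HostPlayer.coinMeasure,
      ∀ p : Fin n, HostPlayer.Correct 𝒮 ω p → HostPlayer.Returns 𝒮 ω p) ∧
    ∀ j : ℕ, 1 ≤ j →
      1 / 2 ≤ HostPlayer.coinMeasure {ω | ∀ p : Fin n, ¬ HostPlayer.EntersRound 𝒮 ω p (j + 1)} := by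
  obtain ⟨f, hf⟩ := hwsl .R1
  refine ⟨?_, fun j hj => ?_⟩
  -- Almost surely some `J` has a flip up to round `J` that is not bad; then no process gets beyond
  -- round `J`.
  · filter_upwards [HostPlayer.ae_exists_notMem_badFlips 𝒮 f] with ω ⟨J, hJ⟩ p hp
    refine (HostPlayer.isExecution_run 𝒮 ω).exists_returned hwf (J := J) (fun t => ?_) hp
    by_contra! h
    exact hJ (HostPlayer.mem_badFlips_of_round hn hwsl 𝒮 hf h)
  · set S := {ω | ∀ p : Fin n, ¬ HostPlayer.EntersRound 𝒮 ω p (j + 1)} with hS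
    have h1 : Sᶜ ⊆ HostPlayer.badFlips 𝒮 f j := by
      intro ω hω
      simp only [hS, Set.mem_compl_iff, Set.mem_ofPred_eq, not_forall, not_not] at hω
      obtain ⟨p, t, ht⟩ := hω
      exact HostPlayer.mem_badFlips_of_round hn hwsl 𝒮 hf (p := p) (T := t) (by omega)
    have h2 : HostPlayer.coinMeasure Sᶜ ≤ 1 / 2 :=
      (MeasureTheory.measure_mono h1).trans ((HostPlayer.measure_badFlips 𝒮 f j).trans
        (pow_le_of_le_one zero_le (by simp) (by omega)))
    -- Subadditivity suffices here, so measurability of `S` plays no role.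
    have h3 : (1 : ENNReal) ≤ HostPlayer.coinMeasure S + HostPlayer.coinMeasure Sᶜ := by
      rw [← MeasureTheory.measure_univ (μ := HostPlayer.coinMeasure), ← Set.union_compl_self S]
      exact MeasureTheory.measure_union_le _ _
    have h4 : (1 : ENNReal) ≤ HostPlayer.coinMeasure S + 1 / 2 := h3.trans (by gcongr)
    have h5 : (1 : ENNReal) - 1 / 2 = 1 / 2 := by simp
    rw [← h5]
    exact tsub_le_iff_right.mpr h4
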